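/- Let $P$ be a natural unit interval order of size $n$, i.e. a poset on an $n$-element set $V$ of positive integers such that (1) $x<_P y$ implies $x<y$, and (2) if $x<_P z$ and $y$ is incomparable in $P$ to both $x$ and $z$, then $x<y<z$. Write $V=\{v_1<\dots<v_n\}$, and let $G=\mathrm{inc}(P)$ be the incomparability graph of $P$: its vertex set is $V$ and its edge set $E(G)$ consists of the pairs of distinct $P$-incomparable elements. A $P$-tableau of shape $\lambda\vdash n$ is a filling $T$ of the Young diagram of $\lambda$ (English notation) with the elements of $P$, each used exactly once, such that $y>_P x$ whenever $y$ is immediately to the right of $x$, and $y\not<_P x$ whenever $y$ is immediately below $x$. Let $\mathrm{inv}_G(T)$ be the number of edges $\{x,y\}\in E(G)$ with $x<y$ such that $x$ lies in a lower row of $T$ than $y$. The chromatic quasisymmetric function of $G$ is $X_G(\mathbf x,t)=\sum_\kappa t^{\mathrm{asc}(\kappa)}\prod_{v\in V}x_{\kappa(v)}$, where $\kappa$ runs over all proper colorings of $G$ by positive integers and $\mathrm{asc}(\kappa)$ is the number of edges $\{u,v\}\in E(G)$ with $u<v$ and $\kappa(u)<\kappa(v)$. Write $[m]_t=1+t+\dots+t^{m-1}$.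 Then $$\sum_{T}t^{\mathrm{inv}_G(T)}=\prod_{j=1}^{n-1}[1+a_j]_t,\qquad a_j=|\{i: j<i\le n,\ \{v_j,v_i\}\in E(G)\}|,$$ where $T$ runs over the $P$-tableaux of shape $1^n$. Moreover, $X_G(\mathbf x,t)$ is a finite $\mathbb Q[t]$-linear combination of Schur functions $s_\lambda(\mathbf x)$, and the coefficient of $s_{1^n}$ in this expansion equals $\prod_{j=1}^{n-1}[1+a_j]_t$. This coefficient is therefore positive, unimodal and palindromic with center of symmetry $m/2$, where $m=|E(G)|$; that is, it has the form $\sum_{i=0}^m c_it^i$ with $$0\le c_0\le c_1\le\dots\le c_{\lfloor m/2\rfloor}=c_{\lfloor (m+1)/2\rfloor}\ge\dots\ge c_m\ge 0\quad\text{and}\quad c_i=c_{m-i}\ \text{ for } 0\le i\le m.$$ -/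

import Mathlib

open Polynomial

/-- `P` is a natural unit interval order on the finite set `V` of natural numbers: `x <_P y` implies
`x < y`, and if `x <_P z` and `y` is `P`-incomparable to both `x` and `z`, then `x < y < z`.
Here `P.lt` and `P.le` refer to the poset, and `(x : ℕ) < y` to the natural order. -/
def IsNaturalUnitIntervalOrder {V : Finset ℕ} (P : PartialOrder V) : Prop :=
  (∀ x y : V, P.lt x y → (x : ℕ) < (y : ℕ)) ∧
  (∀ x y z : V, P.lt x z → IncompRel P.le x y → IncompRel P.le z y →
    (x : ℕ) < (y : ℕ) ∧ (y : ℕ) < (z : ℕ))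

/-- The incomparability graph of a poset. -/
def incGraph {V : Finset ℕ} (P : PartialOrder V) : SimpleGraph V where
  Adj x y := IncompRel P.le x y
  symm := ⟨fun _ _ h => ⟨h.2, h.1⟩⟩
  loopless := ⟨fun x h => h.1 (P.le_refl x)⟩

/-- The `t`-number `1 + t + ⋯ + t ^ (m - 1)`. -/
noncomputable def tNumber (m : ℕ) : ℚ[X] := ∑ i ∈ Finset.range m, X ^ i

/-- The elements of `V` in increasing order, indexed by `0, …, n - 1`. -/
noncomputable def nthVertex {V : Finset ℕ} {n : ℕ} (hV : V.card = n) (j : Fin n) : V :=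
  V.orderIsoOfFin hV j

/-- The number of edges of `G` whose smaller endpoint is `v`. -/
noncomputable def upDegree {V : Finset ℕ} (G : SimpleGraph V) (v : V) : ℕ :=
  {w : V | G.Adj v w ∧ (v : ℕ) < (w : ℕ)}.ncard

/-! ### Tableaux of a poset -/

/-- `P`-tableaux of shape `μ` (English notation: `(i, j)` is the cell in row `i` and column `j`).
Every element of `P` appears exactly once; rows increase in `P`; an entry is not `P`-below the entry
immediately above it. -/
def PTableau {V : Finset ℕ} (P : PartialOrder V) (μ : YoungDiagram) : Type :=
  {T : {c : ℕ × ℕ // c ∈ μ} ≃ V //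
    (∀ (i j : ℕ) (h : (i, j) ∈ μ) (h' : (i, j + 1) ∈ μ), P.lt (T ⟨(i, j), h⟩) (T ⟨(i, j + 1), h'⟩)) ∧
    (∀ (i j : ℕ) (h : (i, j) ∈ μ) (h' : (i + 1, j) ∈ μ),
      ¬ P.lt (T ⟨(i + 1, j), h'⟩) (T ⟨(i, j), h⟩))}

instance instFinitePTableau {V : Finset ℕ} (P : PartialOrder V) (μ : YoungDiagram) :
    Finite (PTableau P μ) := by
  have : Finite {c : ℕ × ℕ // c ∈ μ} := Finite.of_fintype {c : ℕ × ℕ // c ∈ μ.cells}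
  unfold PTableau
  infer_instance

noncomputable instance instFintypePTableau {V : Finset ℕ} (P : PartialOrder V) (μ : YoungDiagram) :
    Fintype (PTableau P μ) := Fintype.ofFinite _

/-- The row of `T` (counted from the top) that contains `x`. -/
def PTableau.row {V : Finset ℕ} {P : PartialOrder V} {μ : YoungDiagram} (T : PTableau P μ)
    (x : V) : ℕ := (T.1.symm x).1.1

/-- The number of edges `{x, y}` of the incomparability graph with `x < y` such that `x` appears
below `y` in `T`. -/
noncomputable def PTableau.inv {V : Finset ℕ} {P : PartialOrder V} {μ : YoungDiagram}
    (T : PTableau P μ) : ℕ :=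
  {e : V × V | (incGraph P).Adj e.1 e.2 ∧ (e.1 : ℕ) < (e.2 : ℕ) ∧ T.row e.2 < T.row e.1}.ncard

/-- The Young diagram of the partition `1 ^ n`: one column of `n` cells. -/
def columnShape (n : ℕ) : YoungDiagram where
  cells := Finset.range n ×ˢ {0}
  isLowerSet := by
    rintro ⟨a, b⟩ ⟨c, d⟩ ⟨h₁, h₂⟩ h
    simp only [Finset.coe_product, Finset.coe_range, Finset.coe_singleton, Set.mem_prod,
      Set.mem_Iio, Set.mem_singleton_iff] at h h₁ h₂ ⊢
    omega

/-! ### Chromatic quasisymmetric functions and Schur functions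

Both are formal power series in countably many ordered variables. Variables, colours and tableau
entries are numbered `0, 1, 2, …`, so that the variable with index `i` is the one usually called
`x_{i+1}`. -/

/-- The exponent vector of the monomial `∏ v, x_{κ v}`. -/
noncomputable def colorContent {V : Finset ℕ} {G : SimpleGraph V} (κ : G.Coloring ℕ) : ℕ →₀ ℕ :=
  ∑ v : V, Finsupp.single (κ v) 1

/-- The number of edges `{u, v}` with `u < v` and `κ u < κ v`. -/
noncomputable def ascents {V : Finset ℕ} {G : SimpleGraph V} (κ : G.Coloring ℕ) : ℕ :=
  {e : V × V | G.Adj e.1 e.2 ∧ (e.1 : ℕ) < (e.2 : ℕ) ∧ κ e.1 < κ e.2}.ncard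

instance instFiniteColoring {V : Finset ℕ} (G : SimpleGraph V) (d : ℕ →₀ ℕ) :
    Finite {κ : G.Coloring ℕ // colorContent κ = d} := by
  have key : ∀ (κ : {κ : G.Coloring ℕ // colorContent κ = d}) (v : V), κ.1 v ∈ d.support := by
    rintro ⟨κ, rfl⟩ v
    simp only [Finsupp.mem_support_iff, colorContent, Finsupp.finsetSum_apply]
    refine (lt_of_lt_of_le ?_ (Finset.single_le_sum
      (f := fun w : V => (Finsupp.single (κ w) 1 : ℕ →₀ ℕ) (κ v))
      (fun _ _ => Nat.zero_le _) (Finset.mem_univ v))).ne'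
    simp
  refine Finite.of_injective
    (fun κ (v : V) => (⟨κ.1 v, key κ v⟩ : {m // m ∈ d.support})) ?_
  intro κ κ' h
  apply Subtype.ext
  apply RelHom.ext
  intro v
  exact congrArg Subtype.val (congrFun h v)

noncomputable instance instFintypeColoring {V : Finset ℕ} (G : SimpleGraph V) (d : ℕ →₀ ℕ) :
    Fintype {κ : G.Coloring ℕ // colorContent κ = d} := Fintype.ofFinite _

/-- The chromatic quasisymmetric function `∑ κ, t ^ asc κ * x_κ`, the sum running over all proper
colourings: its coefficient at `x ^ d` is the sum of `t ^ asc κ` over the finitely many proper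
colourings `κ` with `x_κ = x ^ d`. -/
noncomputable def chromaticQSym {V : Finset ℕ} (G : SimpleGraph V) : MvPowerSeries ℕ ℚ[X] :=
  fun d => ∑ κ : {κ : G.Coloring ℕ // colorContent κ = d}, X ^ ascents κ.1

/-- The exponent vector of the monomial `x ^ T` of a semistandard Young tableau `T`. -/
noncomputable def tableauContent {μ : YoungDiagram} (T : SemistandardYoungTableau μ) : ℕ →₀ ℕ :=
  ∑ c ∈ μ.cells, Finsupp.single (T c.1 c.2) 1

instance instFiniteTableau (μ : YoungDiagram) (d : ℕ →₀ ℕ) :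
    Finite {T : SemistandardYoungTableau μ // tableauContent T = d} := by
  have key : ∀ (T : {T : SemistandardYoungTableau μ // tableauContent T = d})
      (c : {c : ℕ × ℕ // c ∈ μ.cells}), T.1 c.1.1 c.1.2 ∈ d.support := by
    rintro ⟨T, rfl⟩ ⟨c, hc⟩
    simp only [Finsupp.mem_support_iff, tableauContent, Finsupp.finsetSum_apply]
    refine (lt_of_lt_of_le ?_ (Finset.single_le_sum
      (f := fun w : ℕ × ℕ => (Finsupp.single (T w.1 w.2) 1 : ℕ →₀ ℕ) (T c.1 c.2))
      (fun _ _ => Nat.zero_le _) hc)).ne'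
    simp
  refine Finite.of_injective
    (fun T (c : {c : ℕ × ℕ // c ∈ μ.cells}) =>
      (⟨T.1 c.1.1 c.1.2, key T c⟩ : {m // m ∈ d.support})) ?_
  intro T T' h
  apply Subtype.ext
  apply SemistandardYoungTableau.ext
  intro i j
  by_cases hij : (i, j) ∈ μ
  · exact congrArg Subtype.val (congrFun h ⟨(i, j), hij⟩)
  · rw [T.1.zeros hij, T'.1.zeros hij]

/-- The Schur function `s_μ = ∑ T, x ^ T`, the sum running over all semistandard Young tableaux of
shape `μ`, with coefficients in `R`. -/
noncomputable def schurFunction (R : Type*) [CommSemiring R] (μ : YoungDiagram) :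
    MvPowerSeries ℕ R :=
  fun d => (Nat.card {T : SemistandardYoungTableau μ // tableauContent T = d} : R)

/-- `f = ∑ μ, c μ * s_μ`, a finite sum over partitions with coefficients in `R`. -/
def IsSchurExpansion {R : Type*} [CommSemiring R] (f : MvPowerSeries ℕ R)
    (c : YoungDiagram →₀ R) : Prop :=
  f = c.sum fun μ a => a • schurFunction R μ

/-! ### Positivity, unimodality and palindromicity -/

/-- `f = ∑ i ≤ m, a_i t ^ i` is positive, unimodal and palindromic with center of symmetry `m / 2`:
`0 ≤ a_0 ≤ ⋯ ≤ a_{⌊m/2⌋} = a_{⌊(m+1)/2⌋} ≥ ⋯ ≥ a_m ≥ 0` and `a_i = a_{m-i}`. -/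
structure IsPositiveUnimodalPalindromic (f : ℚ[X]) (m : ℕ) : Prop where
  natDegree_le : f.natDegree ≤ m
  nonneg : ∀ i, 0 ≤ f.coeff i
  increasing : ∀ i, i < m / 2 → f.coeff i ≤ f.coeff (i + 1)
  middle : f.coeff (m / 2) = f.coeff ((m + 1) / 2)
  decreasing : ∀ i, (m + 1) / 2 ≤ i → i < m → f.coeff (i + 1) ≤ f.coeff i
  palindromic : ∀ i, i ≤ m → f.coeff i = f.coeff (m - i)

/-! Everything rests on two properties of G = inc(P): the larger neighbours of a vertex form a
clique (`incGraph_adj_of_common_lower`), and a vertex lying between two adjacent ones is adjacent to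
both (`incGraph_adj_of_between`).

The clique property gives both product formulas by removing the least vertex c. Ordered set
partitions are encoded as packed functions; let N be the set of neighbours of c among the remaining
vertices. In a column (`sum_columns`), c can be inserted at the top or directly below a member of N.
These 1 + |N| places create 0, 1, …, |N| new inversions, hence a factor [1 + |N|]_t.

The coefficient of s_{1^n} is read off by a linear functional. Since e_n = ∑_α (-1)^{n-ℓ(α)} h_α
over compositions α of n, and pairing with h_α extracts the coefficient of x^α, a signed sum of
coefficients at packed exponents (`alternatingCoeff`) must do it. This is verified directly on Schur
functions: for a shape other than a column, merging or separating the last cell of the first row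
cancels all terms. On X_G the functional is a signed sum over ordered partitions into independent
sets (`alternating_sum_proper`). Inserting c as a new block at position v and adding it to the old
block v give the same power of t with opposite signs. What survives is the last position, together
with those v for which the old block v contains a neighbour of c. As N is a clique, there are |N|
such blocks, and the surviving powers are t^0, …, t^{|N|}.

For the existence of a Schur expansion, X_G has to be symmetric. Merging the colours i and i + 1
reduces this to two-colourings of a vertex set W. By the second property, W either contains a
triangle or induces a disjoint union of monotone paths, whose two-colourings are symmetric
(`twoColorSum_comm`). Schur functions are symmetric by the Bender–Knuth involution, and they are
unitriangular with respect to the weight ∑ i * d i of exponents, so they span the homogeneous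
symmetric functions of each degree.

Finally, multiplication by a t-number preserves symmetry and unimodality of the coefficients, and
the numbers a_j add up to |E(G)|. -/

/-! ### Packed functions -/

section Packed

set_option linter.unusedSectionVars false

variable {α : Type*} [Fintype α] [DecidableEq α]

/-- The nonzero values of `f` are attained exactly on `A` and form an initial segment `1, …, ℓ`. Such
functions encode the ordered set partitions of `A`. -/
def IsPacked (A : Finset α) (f : α → ℕ) : Prop :=
  (∀ a, f a = 0 ↔ a ∉ A) ∧ ∀ a k, 1 ≤ k → k ≤ f a → ∃ b, f b = k

open Classical in
/-- The finite set of packed functions on `A`. -/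
noncomputable def packedFunctions (A : Finset α) : Finset (α → ℕ) :=
  (Fintype.piFinset fun _ => Finset.range (Fintype.card α + 1)).filter (IsPacked A)

-- The bound on the values in `packedFunctions` excludes nothing: if 1, …, f a are all attained,
-- then f a is at most the number of points.
open Classical in
theorem mem_packedFunctions {A : Finset α} {f : α → ℕ} :
    f ∈ packedFunctions A ↔
      (∀ a, f a = 0 ↔ a ∉ A) ∧ ∀ a k, 1 ≤ k → k ≤ f a → ∃ b, f b = k := by
  refine Finset.mem_filter.trans ?_
  refine and_iff_right_of_imp ?_
  rintro ⟨_, h⟩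
  simp only [Fintype.mem_piFinset, Finset.mem_range, Nat.lt_succ_iff]
  intro a
  have : Finset.Icc 1 (f a) ⊆ Finset.univ.image f := by
    intro k hk
    rw [Finset.mem_Icc] at hk
    obtain ⟨b, hb⟩ := h a k hk.1 hk.2
    exact Finset.mem_image.2 ⟨b, Finset.mem_univ _, hb⟩
  simpa using (Finset.card_le_card this).trans Finset.card_image_le

/-- The number of blocks of a packed function. -/
def blockCount (f : α → ℕ) : ℕ := Finset.univ.sup f

theorem le_blockCount (f : α → ℕ) (a : α) : f a ≤ blockCount f :=
  Finset.le_sup (f := f) (Finset.mem_univ a)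

theorem exists_eq_blockCount (f : α → ℕ) (h : 1 ≤ blockCount f) : ∃ a, f a = blockCount f := by
  have hne : (Finset.univ : Finset α).Nonempty := by
    by_contra hne
    rw [Finset.not_nonempty_iff_eq_empty] at hne
    simp [blockCount, hne] at h
  obtain ⟨a, -, ha⟩ := Finset.exists_mem_eq_sup _ hne f
  exact ⟨a, ha.symm⟩

theorem exists_eq_of_mem_packedFunctions {A : Finset α} {f : α → ℕ} (hf : f ∈ packedFunctions A)
    {k : ℕ} (h1 : 1 ≤ k) (hk : k ≤ blockCount f) : ∃ b, f b = k := by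
  obtain ⟨a, ha⟩ := exists_eq_blockCount f (h1.trans hk)
  exact (mem_packedFunctions.1 hf).2 a k h1 (ha ▸ hk)

theorem blockCount_eq {f : α → ℕ} {m : ℕ} (h : ∀ a, f a ≤ m) (h' : 1 ≤ m → ∃ a, f a = m) :
    blockCount f = m := by
  refine le_antisymm (Finset.sup_le fun a _ => h a) ?_
  rcases Nat.eq_zero_or_pos m with rfl | hm
  · exact Nat.zero_le _
  · obtain ⟨a, ha⟩ := h' hm
    exact ha ▸ le_blockCount f a

/-- Insert `c` as a new block in position `v`. -/
def insertBlock (g : α → ℕ) (c : α) (v : ℕ) : α → ℕ :=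
  fun x => if x = c then v else if v ≤ g x then g x + 1 else g x

/-- Remove the block of `c`. -/
def removeBlock (f : α → ℕ) (c : α) : α → ℕ :=
  fun x => if x = c then 0 else if f c < f x then f x - 1 else f x

theorem insertBlock_self (g : α → ℕ) (c : α) (v : ℕ) : insertBlock g c v c = v := by
  simp [insertBlock]

theorem insertBlock_of_ne (g : α → ℕ) {c x : α} (v : ℕ) (h : x ≠ c) :
    insertBlock g c v x = if v ≤ g x then g x + 1 else g x := by
  simp [insertBlock, h]

theorem insertBlock_ne (g : α → ℕ) {c x : α} (v : ℕ) (h : x ≠ c) : insertBlock g c v x ≠ v := by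
  rw [insertBlock_of_ne g v h]; split_ifs <;> omega

theorem blockCount_insertBlock {A : Finset α} {c : α} (hc : c ∉ A) {g : α → ℕ}
    (hg : g ∈ packedFunctions A) {v : ℕ} (hv : v ∈ Finset.Icc 1 (blockCount g + 1)) :
    blockCount (insertBlock g c v) = blockCount g + 1 := by
  rw [Finset.mem_Icc] at hv
  have hgc : g c = 0 := ((mem_packedFunctions.1 hg).1 c).2 hc
  refine blockCount_eq (fun a => ?_) fun _ => ?_
  · have := le_blockCount g a
    unfold insertBlock; split_ifs <;> omega
  · rcases hv.2.eq_or_lt with h | h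
    · exact ⟨c, by rw [insertBlock_self, h]⟩
    · obtain ⟨a, ha⟩ := exists_eq_blockCount g (by omega)
      have hac : a ≠ c := by rintro rfl; omega
      exact ⟨a, by rw [insertBlock_of_ne g v hac, if_pos (by omega), ha]⟩

theorem blockCount_update {A : Finset α} {c : α} (hc : c ∉ A) {g : α → ℕ}
    (hg : g ∈ packedFunctions A) {v : ℕ} (hv : v ∈ Finset.Icc 1 (blockCount g)) :
    blockCount (Function.update g c v) = blockCount g := by
  rw [Finset.mem_Icc] at hv
  have hgc : g c = 0 := ((mem_packedFunctions.1 hg).1 c).2 hc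
  refine blockCount_eq (fun a => ?_) fun h => ?_
  · have := le_blockCount g a
    by_cases h : a = c
    · subst h; simpa using hv.2
    · simpa [h] using this
  · obtain ⟨a, ha⟩ := exists_eq_blockCount g h
    have hac : a ≠ c := by rintro rfl; omega
    exact ⟨a, by simpa [hac] using ha⟩

theorem insertBlock_mem {A : Finset α} {c : α} (hc : c ∉ A) {g : α → ℕ}
    (hg : g ∈ packedFunctions A) {v : ℕ} (hv : v ∈ Finset.Icc 1 (blockCount g + 1)) :
    insertBlock g c v ∈ packedFunctions (insert c A) := by
  rw [Finset.mem_Icc] at hv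
  have hgc : g c = 0 := ((mem_packedFunctions.1 hg).1 c).2 hc
  refine mem_packedFunctions.2 ⟨fun a => ?_, fun a k h1 hk => ?_⟩
  · by_cases h : a = c
    · subst h; simp [insertBlock_self]; omega
    · have h0a := (mem_packedFunctions.1 hg).1 a
      rw [insertBlock_of_ne g v h, Finset.mem_insert, not_or]
      simp only [h, not_false_eq_true, true_and]
      rw [← h0a]
      split_ifs
      · simp; omega
      · rfl
  · rcases lt_trichotomy k v with h | h | h
    · obtain ⟨b, hb⟩ := exists_eq_of_mem_packedFunctions hg h1 (by omega)
      have hbc : b ≠ c := by rintro rfl; omega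
      exact ⟨b, by rw [insertBlock_of_ne g v hbc, if_neg (by omega), hb]⟩
    · exact ⟨c, by rw [insertBlock_self, h]⟩
    · have hk' : k ≤ blockCount g + 1 :=
        hk.trans ((le_blockCount _ a).trans
          (blockCount_insertBlock hc hg (Finset.mem_Icc.2 hv)).le)
      obtain ⟨b, hb⟩ := exists_eq_of_mem_packedFunctions hg (k := k - 1) (by omega) (by omega)
      have hbc : b ≠ c := by rintro rfl; omega
      exact ⟨b, by rw [insertBlock_of_ne g v hbc, if_pos (by omega)]; omega⟩

theorem update_mem {A : Finset α} {c : α} (hc : c ∉ A) {g : α → ℕ}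
    (hg : g ∈ packedFunctions A) {v : ℕ} (hv : v ∈ Finset.Icc 1 (blockCount g)) :
    Function.update g c v ∈ packedFunctions (insert c A) := by
  have hgc : g c = 0 := ((mem_packedFunctions.1 hg).1 c).2 hc
  refine mem_packedFunctions.2 ⟨fun a => ?_, fun a k h1 hk => ?_⟩
  · rw [Finset.mem_Icc] at hv
    by_cases h : a = c
    · subst h; simp; omega
    · simp [h, (mem_packedFunctions.1 hg).1 a]
  · have hk' : k ≤ blockCount g :=
      hk.trans ((le_blockCount _ a).trans (blockCount_update hc hg hv).le)
    obtain ⟨b, hb⟩ := exists_eq_of_mem_packedFunctions hg h1 hk'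
    have hbc : b ≠ c := by rintro rfl; omega
    exact ⟨b, by simpa [hbc] using hb⟩

theorem removeBlock_insertBlock {g : α → ℕ} {c : α} (hgc : g c = 0) (v : ℕ) :
    removeBlock (insertBlock g c v) c = g := by
  funext x
  by_cases h : x = c
  · subst h; simp [removeBlock, hgc]
  · simp only [removeBlock, h, if_false, insertBlock_self, insertBlock_of_ne g v h]
    split_ifs <;> omega

theorem insertBlock_removeBlock {f : α → ℕ} {c : α} (hf : ∀ b, b ≠ c → f b ≠ f c) :
    insertBlock (removeBlock f c) c (f c) = f := by
  funext x
  by_cases h : x = c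
  · subst h; simp [insertBlock]
  · have := hf x h
    simp only [insertBlock, removeBlock, h, if_false]
    split_ifs <;> omega

theorem removeBlock_mem {A : Finset α} {c : α} (hc : c ∉ A) {f : α → ℕ}
    (hf : f ∈ packedFunctions (insert c A)) (h : ∀ b, b ≠ c → f b ≠ f c) :
    removeBlock f c ∈ packedFunctions A ∧
      f c ∈ Finset.Icc 1 (blockCount (removeBlock f c) + 1) := by
  have h0 := (mem_packedFunctions.1 hf).1
  have hfc : f c ≠ 0 := fun h' => by simpa using (h0 c).1 h'
  constructor
  · refine mem_packedFunctions.2 ⟨fun a => ?_, fun a k h1 hk => ?_⟩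
    · by_cases hac : a = c
      · subst hac; simp [removeBlock, hc]
      · have h0a := h0 a
        have := h a hac
        simp only [Finset.mem_insert, hac, false_or] at h0a
        rw [← h0a]
        simp only [removeBlock, hac, if_false]
        split_ifs <;> omega
    · have hac : a ≠ c := by rintro rfl; simp [removeBlock] at hk; omega
      simp only [removeBlock, hac, if_false] at hk
      by_cases hkc : k < f c
      · obtain ⟨b, hb⟩ := (mem_packedFunctions.1 hf).2 c k h1 hkc.le
        have hbc : b ≠ c := by rintro rfl; omega
        refine ⟨b, ?_⟩
        simp only [removeBlock, hbc, if_false]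
        split_ifs <;> omega
      · have hka : k + 1 ≤ f a := by
          have := h a hac
          split_ifs at hk <;> omega
        obtain ⟨b, hb⟩ := (mem_packedFunctions.1 hf).2 a (k + 1) (by omega) hka
        have hbc : b ≠ c := by rintro rfl; omega
        refine ⟨b, ?_⟩
        simp only [removeBlock, hbc, if_false]
        split_ifs <;> omega
  · rw [Finset.mem_Icc]
    refine ⟨by omega, ?_⟩
    by_contra hlt
    push Not at hlt
    -- The value just below that of `c` is attained outside `c` and survives the removal, so it is
    -- bounded by the remaining number of blocks.
    obtain ⟨b, hb⟩ := (mem_packedFunctions.1 hf).2 c (f c - 1) (by omega) (by omega)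
    have hbc : b ≠ c := by rintro rfl; omega
    have := le_blockCount (removeBlock f c) b
    simp only [removeBlock, hbc, if_false] at this
    split_ifs at this <;> omega

theorem update_zero_mem {A : Finset α} {c : α} (hc : c ∉ A) {f : α → ℕ}
    (hf : f ∈ packedFunctions (insert c A)) {b : α} (hb : b ≠ c) (h : f b = f c) :
    Function.update f c 0 ∈ packedFunctions A ∧
      f c ∈ Finset.Icc 1 (blockCount (Function.update f c 0)) := by
  have h0 := (mem_packedFunctions.1 hf).1
  have hfc : f c ≠ 0 := fun h' => by simpa using (h0 c).1 h'
  constructor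
  · refine mem_packedFunctions.2 ⟨fun a => ?_, fun a k h1 hk => ?_⟩
    · by_cases hac : a = c
      · subst hac; simp [hc]
      · have h0a := h0 a
        simp only [Finset.mem_insert, hac, false_or] at h0a
        simpa [hac] using h0a
    · have hac : a ≠ c := by rintro rfl; simp at hk; omega
      simp only [ne_eq, hac, not_false_eq_true, Function.update_of_ne] at hk
      obtain ⟨d, hd⟩ := (mem_packedFunctions.1 hf).2 a k h1 hk
      by_cases hdc : d = c
      · subst hdc
        exact ⟨b, by simpa [hb, h] using hd⟩
      · exact ⟨d, by simpa [hdc] using hd⟩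
  · rw [Finset.mem_Icc]
    refine ⟨by omega, ?_⟩
    have := le_blockCount (Function.update f c 0) b
    simpa [hb, h] using this

/-- A packed function on `insert c A` arises from one on `A` by inserting `c` as a block of its own
or by adding `c` to an existing block. -/
theorem sum_packedFunctions_insert {R : Type*} [AddCommMonoid R] {A : Finset α} {c : α}
    (hc : c ∉ A) (φ : (α → ℕ) → R) :
    ∑ f ∈ packedFunctions (insert c A), φ f =
      ∑ g ∈ packedFunctions A, (∑ v ∈ Finset.Icc 1 (blockCount g + 1), φ (insertBlock g c v) +
        ∑ v ∈ Finset.Icc 1 (blockCount g), φ (Function.update g c v)) := by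
  -- Split according to whether `c` is alone in its block.
  rw [Finset.sum_add_distrib, ← Finset.sum_filter_add_sum_filter_not _
    (fun f : α → ℕ => ∀ b, b ≠ c → f b ≠ f c), Finset.sum_sigma', Finset.sum_sigma']
  have hg0 : ∀ g ∈ packedFunctions A, g c = 0 :=
    fun g hg => ((mem_packedFunctions.1 hg).1 c).2 hc
  congr 1
  · refine Finset.sum_bij' (fun f _ => ⟨removeBlock f c, f c⟩)
      (fun p _ => insertBlock p.1 c p.2) ?_ ?_ ?_ ?_ ?_
    · intro f hf
      rw [Finset.mem_filter] at hf
      exact Finset.mem_sigma.2 (removeBlock_mem hc hf.1 hf.2)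
    · intro p hp
      rw [Finset.mem_sigma] at hp
      refine Finset.mem_filter.2 ⟨insertBlock_mem hc hp.1 hp.2, fun b hb => ?_⟩
      rw [insertBlock_self]
      exact insertBlock_ne _ _ hb
    · intro f hf
      exact insertBlock_removeBlock (Finset.mem_filter.1 hf).2
    · rintro ⟨g, v⟩ hp
      rw [Finset.mem_sigma] at hp
      simp only [removeBlock_insertBlock (hg0 g hp.1), insertBlock_self]
    · intro f hf
      rw [insertBlock_removeBlock (Finset.mem_filter.1 hf).2]
  · refine Finset.sum_bij' (fun f _ => ⟨Function.update f c 0, f c⟩)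
      (fun p _ => Function.update p.1 c p.2) ?_ ?_ ?_ ?_ ?_
    · intro f hf
      rw [Finset.mem_filter] at hf
      obtain ⟨hf, h⟩ := hf
      push Not at h
      obtain ⟨b, hb, h⟩ := h
      exact Finset.mem_sigma.2 (update_zero_mem hc hf hb h)
    · rintro ⟨g, v⟩ hp
      rw [Finset.mem_sigma] at hp
      refine Finset.mem_filter.2 ⟨update_mem hc hp.1 hp.2, ?_⟩
      push Not
      have hv := Finset.mem_Icc.1 hp.2
      obtain ⟨b, hb⟩ := exists_eq_of_mem_packedFunctions hp.1 hv.1 hv.2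
      have hbc : b ≠ c := by
        rintro rfl
        have := hg0 g hp.1
        simp only at hb hv
        omega
      exact ⟨b, hbc, by simpa [hbc] using hb⟩
    · intro f _
      simp
    · rintro ⟨g, v⟩ hp
      rw [Finset.mem_sigma] at hp
      have := hg0 g hp.1
      simp [← this]
    · intro f _
      simp

theorem packedFunctions_empty : packedFunctions (∅ : Finset α) = {0} := by
  ext f
  rw [mem_packedFunctions, Finset.mem_singleton]
  constructor
  · rintro ⟨h, -⟩
    funext a
    simpa using h a
  · rintro rfl
    refine ⟨by simp, fun a k h1 hk => ?_⟩
    simp only [Pi.zero_apply] at hk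
    omega

theorem blockCount_zero : blockCount (0 : α → ℕ) = 0 := by
  simp [blockCount]

end Packed

/-! ### Inserting a minimal vertex -/

section InsertMin

set_option linter.unusedSectionVars false

/-- The exponent is the rank of m counted from the top of M, so each of 1, …, |M| occurs once. -/
theorem sum_X_pow_card_le {β : Type*} [LinearOrder β] (M : Finset β) :
    ∑ m ∈ M, (X : ℚ[X]) ^ (M.filter fun m' => m ≤ m').card =
      ∑ i ∈ Finset.range M.card, X ^ (i + 1) := by
  induction M using Finset.induction_on_min with
  | empty => simp
  | insert a M ha ih =>
    have haM : a ∉ M := fun h => lt_irrefl a (ha a h)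
    rw [Finset.sum_insert haM, Finset.card_insert_of_notMem haM, Finset.sum_range_succ, ← ih,
      add_comm]
    congr 1
    · refine Finset.sum_congr rfl fun m hm => ?_
      rw [Finset.filter_insert, if_neg (not_le.2 (ha m hm))]
    · rw [Finset.filter_true_of_mem, Finset.card_insert_of_notMem haM]
      intro m hm
      rcases Finset.mem_insert.1 hm with rfl | h
      · exact le_rfl
      · exact (ha m h).le

theorem sum_X_pow_card_le_of_injOn {α β : Type*} [LinearOrder β] (N : Finset α) {g : α → β}
    (hg : Set.InjOn g N) :
    ∑ w ∈ N, (X : ℚ[X]) ^ (N.filter fun w' => g w ≤ g w').card =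
      ∑ i ∈ Finset.range N.card, X ^ (i + 1) := by
  classical
  rw [← Finset.card_image_of_injOn hg, ← sum_X_pow_card_le, Finset.sum_image hg]
  refine Finset.sum_congr rfl fun w _ => ?_
  rw [Finset.filter_image, Finset.card_image_of_injOn]
  exact hg.mono fun x hx => (Finset.mem_filter.1 (Finset.mem_coe.1 hx)).1

theorem tNumber_one_add (a : ℕ) :
    tNumber (1 + a) = 1 + ∑ i ∈ Finset.range a, X ^ (i + 1) := by
  rw [tNumber, add_comm 1 a, Finset.sum_range_succ', pow_zero, add_comm]

open Classical in
theorem sum_ite_exists_eq {α R : Type*} [AddCommMonoid R] (N : Finset α) {g : α → ℕ}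
    (hg : Set.InjOn g N) {s : Finset ℕ} (hs : ∀ w ∈ N, g w ∈ s) (φ : ℕ → R) :
    ∑ v ∈ s, (if ∃ w ∈ N, g w = v then φ v else 0) = ∑ w ∈ N, φ (g w) := by
  rw [← Finset.sum_filter, ← Finset.sum_image (f := φ) hg]
  refine Finset.sum_congr ?_ fun _ _ => rfl
  ext v
  simp only [Finset.mem_filter, Finset.mem_image]
  constructor
  · exact fun h => h.2
  · rintro ⟨w, hw, rfl⟩
    exact ⟨hs w hw, w, hw, rfl⟩

variable {α : Type*} [LinearOrder α]

open Classical in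
/-- The number of edges `{x, y}` of `G` within `A` with `x < y` and `r (f x) (f y)`. -/
noncomputable def edgeCount (G : SimpleGraph α) (r : ℕ → ℕ → Prop) (A : Finset α) (f : α → ℕ) : ℕ :=
  ((A ×ˢ A).filter fun e => G.Adj e.1 e.2 ∧ e.1 < e.2 ∧ r (f e.1) (f e.2)).card

open Classical in
/-- The neighbours of `c` in `A`. -/
noncomputable def neighborsIn (G : SimpleGraph α) (A : Finset α) (c : α) : Finset α :=
  A.filter fun w => G.Adj c w

theorem mem_neighborsIn {G : SimpleGraph α} {A : Finset α} {c w : α} :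
    w ∈ neighborsIn G A c ↔ w ∈ A ∧ G.Adj c w := by
  simp [neighborsIn]

open Classical in
theorem edgeCount_congr {G : SimpleGraph α} {r : ℕ → ℕ → Prop} {A : Finset α} {f g : α → ℕ}
    (h : ∀ x ∈ A, ∀ y ∈ A, r (f x) (f y) ↔ r (g x) (g y)) :
    edgeCount G r A f = edgeCount G r A g := by
  unfold edgeCount
  congr 1
  refine Finset.filter_congr fun e he => ?_
  rw [Finset.mem_product] at he
  rw [h _ he.1 _ he.2]

/-- As `c` lies below all of `A`, it is the smaller endpoint of every new edge. -/
theorem edgeCount_insert {G : SimpleGraph α} {r : ℕ → ℕ → Prop} [DecidableRel r] {A : Finset α} {c : α}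
    (hc : ∀ x ∈ A, c < x) (f : α → ℕ) :
    edgeCount G r (insert c A) f =
      edgeCount G r A f + ((neighborsIn G A c).filter fun w => r (f c) (f w)).card := by
  have hcA : c ∉ A := fun h => lt_irrefl c (hc c h)
  rw [← Finset.card_map ⟨fun w => (c, w), Prod.mk_right_injective c⟩, edgeCount, edgeCount,
    ← Finset.card_union_of_disjoint]
  · congr 1
    ext ⟨x, y⟩
    simp only [Finset.mem_filter, Finset.mem_product, Finset.mem_insert, Finset.mem_union,
      Finset.mem_map, Function.Embedding.coeFn_mk, Prod.mk.injEq, mem_neighborsIn]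
    constructor
    · rintro ⟨⟨rfl | hx, rfl | hy⟩, h1, h2, h3⟩
      · exact absurd h2 (lt_irrefl _)
      · exact Or.inr ⟨y, ⟨⟨hy, h1⟩, h3⟩, rfl, rfl⟩
      · exact absurd h2 (hc x hx).not_gt
      · exact Or.inl ⟨⟨hx, hy⟩, h1, h2, h3⟩
    · rintro (⟨⟨hx, hy⟩, h⟩ | ⟨w, ⟨⟨hw, h1⟩, h3⟩, rfl, rfl⟩)
      · exact ⟨⟨Or.inr hx, Or.inr hy⟩, h⟩
      · exact ⟨⟨Or.inl rfl, Or.inr hw⟩, h1, hc w hw, h3⟩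
  · rw [Finset.disjoint_left]
    rintro ⟨x, y⟩ h h'
    simp only [Finset.mem_filter, Finset.mem_product, Finset.mem_map, Function.Embedding.coeFn_mk,
      Prod.mk.injEq] at h h'
    obtain ⟨w, -, rfl, rfl⟩ := h'
    exact hcA h.1.1

open Classical in
theorem prod_insert_min {G : SimpleGraph α} {A : Finset α} {c : α} (hc : ∀ x ∈ A, c < x) :
    ∏ v ∈ insert c A, tNumber (1 + ((neighborsIn G (insert c A) v).filter fun w => v < w).card) =
      tNumber (1 + (neighborsIn G A c).card) *
        ∏ v ∈ A, tNumber (1 + ((neighborsIn G A v).filter fun w => v < w).card) := by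
  have hcA : c ∉ A := fun h => lt_irrefl c (hc c h)
  rw [Finset.prod_insert hcA]
  congr 1
  · congr 3
    ext w
    simp only [Finset.mem_filter, mem_neighborsIn, Finset.mem_insert]
    constructor
    · rintro ⟨⟨rfl | h, h'⟩, h''⟩
      · exact absurd h'' (lt_irrefl _)
      · exact ⟨h, h'⟩
    · exact fun h => ⟨⟨Or.inr h.1, h.2⟩, hc w h.1⟩
  · refine Finset.prod_congr rfl fun v hv => ?_
    congr 3
    ext w
    simp only [Finset.mem_filter, mem_neighborsIn, Finset.mem_insert]
    constructor
    · rintro ⟨⟨rfl | h, h'⟩, h''⟩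
      · exact absurd h'' (hc v hv).not_gt
      · exact ⟨⟨h, h'⟩, h''⟩
    · exact fun h => ⟨⟨Or.inr h.1.1, h.1.2⟩, h.2⟩

variable [Fintype α]

theorem pos_of_mem_packed {A : Finset α} {g : α → ℕ} (hg : g ∈ packedFunctions A) {x : α}
    (hx : x ∈ A) : 1 ≤ g x := by
  have := (mem_packedFunctions.1 hg).1 x
  have : g x ≠ 0 := fun h => this.1 h hx
  omega

theorem mem_of_pos_of_mem_packed {A : Finset α} {g : α → ℕ} (hg : g ∈ packedFunctions A) {x : α}
    (hx : 1 ≤ g x) : x ∈ A := by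
  by_contra h
  have := ((mem_packedFunctions.1 hg).1 x).2 h
  omega

open Classical in
/-- The alternating sum over ordered partitions into independent sets factors. -/
theorem alternating_sum_proper {G : SimpleGraph α}
    (hG : ∀ c x y, c < x → c < y → x ≠ y → G.Adj c x → G.Adj c y → G.Adj x y) (A : Finset α) :
    ∑ f ∈ packedFunctions A, (if ∀ x ∈ A, ∀ y ∈ A, G.Adj x y → f x ≠ f y then
        (-1 : ℚ[X]) ^ (A.card + blockCount f) * X ^ edgeCount G (· < ·) A f else 0) =
      ∏ v ∈ A, tNumber (1 + ((neighborsIn G A v).filter fun w => v < w).card) := by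
  induction A using Finset.induction_on_min with
  | empty => simp [packedFunctions_empty, blockCount_zero, edgeCount]
  | insert c A hc ih =>
    have hcA : c ∉ A := fun h => lt_irrefl c (hc c h)
    rw [prod_insert_min hc, ← ih, sum_packedFunctions_insert hcA, Finset.mul_sum]
    -- The identity holds for each `g` separately: the extensions of `g` to `c` contribute the new
    -- factor times the term of `g`.
    refine Finset.sum_congr rfl fun g hg => ?_
    set N := neighborsIn G A c with hN
    have hNA : ∀ w ∈ N, w ∈ A ∧ w ≠ c ∧ G.Adj c w := fun w hw =>
      ⟨(mem_neighborsIn.1 hw).1, (hc w (mem_neighborsIn.1 hw).1).ne', (mem_neighborsIn.1 hw).2⟩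
    have hneA : ∀ w ∈ A, w ≠ c := fun w hw => (hc w hw).ne'
    have hbad1 : ∀ v, (∀ x ∈ insert c A, ∀ y ∈ insert c A, G.Adj x y →
        insertBlock g c v x ≠ insertBlock g c v y) ↔ ∀ x ∈ A, ∀ y ∈ A, G.Adj x y → g x ≠ g y := by
      intro v
      constructor
      · intro h x hx y hy hxy he
        refine h x (Finset.mem_insert_of_mem hx) y (Finset.mem_insert_of_mem hy) hxy ?_
        rw [insertBlock_of_ne g v (hneA x hx), insertBlock_of_ne g v (hneA y hy), he]
      · intro h x hx y hy hxy
        rcases Finset.mem_insert.1 hx with rfl | hx' <;> rcases Finset.mem_insert.1 hy with rfl | hy'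
        · exact absurd hxy (G.irrefl)
        · rw [insertBlock_self]; exact (insertBlock_ne g v (hneA y hy')).symm
        · rw [insertBlock_self]; exact insertBlock_ne g v (hneA x hx')
        · have := h x hx' y hy' hxy
          rw [insertBlock_of_ne g v (hneA x hx'), insertBlock_of_ne g v (hneA y hy')]
          split_ifs <;> omega
    have hbad2 : ∀ v, (∀ x ∈ insert c A, ∀ y ∈ insert c A, G.Adj x y →
        Function.update g c v x ≠ Function.update g c v y) ↔
        (∀ x ∈ A, ∀ y ∈ A, G.Adj x y → g x ≠ g y) ∧ ¬ ∃ w ∈ N, g w = v := by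
      intro v
      constructor
      · intro h
        refine ⟨fun x hx y hy hxy => ?_, ?_⟩
        · have := h x (Finset.mem_insert_of_mem hx) y (Finset.mem_insert_of_mem hy) hxy
          simpa [hneA x hx, hneA y hy] using this
        · rintro ⟨w, hw, rfl⟩
          obtain ⟨h1, h2, h3⟩ := hNA w hw
          have := h c (Finset.mem_insert_self _ _) w (Finset.mem_insert_of_mem h1) h3
          simp [h2] at this
      · rintro ⟨h, h'⟩ x hx y hy hxy
        rcases Finset.mem_insert.1 hx with rfl | hx' <;> rcases Finset.mem_insert.1 hy with rfl | hy'
        · exact absurd hxy (G.irrefl)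
        · have := fun he => h' ⟨y, mem_neighborsIn.2 ⟨hy', hxy⟩, he⟩
          simpa [hneA y hy'] using fun he => this he.symm
        · have := fun he => h' ⟨x, mem_neighborsIn.2 ⟨hx', hxy.symm⟩, he⟩
          simpa [hneA x hx'] using this
        · simpa [hneA x hx', hneA y hy'] using h x hx' y hy' hxy
    by_cases hp : ∀ x ∈ A, ∀ y ∈ A, G.Adj x y → g x ≠ g y
    swap
    · simp only [hbad1, hbad2, hp, if_false, false_and, Finset.sum_const_zero, mul_zero, add_zero]
    -- The neighbours of `c` form a clique, so a proper `g` separates them.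
    have hinj : Set.InjOn g N := by
      intro x hx y hy hxy
      by_contra hne
      obtain ⟨h1, -, h3⟩ := hNA x hx
      obtain ⟨h1', -, h3'⟩ := hNA y hy
      exact hp x h1 y h1' (hG c x y (hc x h1) (hc y h1') hne h3 h3') hxy
    -- The ascents gained by a new block `{c}` at position `v` come from the neighbours in the old
    -- blocks `v` and later, which are shifted up.
    set ψ : ℕ → ℚ[X] := fun v => X ^ (N.filter fun w => v ≤ g w).card with hψ
    set K : ℚ[X] := (-1) ^ (A.card + blockCount g) * X ^ edgeCount G (· < ·) A g with hK
    have e1 : ∀ v ∈ Finset.Icc 1 (blockCount g + 1),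
        (if ∀ x ∈ insert c A, ∀ y ∈ insert c A, G.Adj x y →
            insertBlock g c v x ≠ insertBlock g c v y then
          (-1 : ℚ[X]) ^ ((insert c A).card + blockCount (insertBlock g c v)) *
            X ^ edgeCount G (· < ·) (insert c A) (insertBlock g c v) else 0) = K * ψ v := by
      intro v hv
      rw [if_pos ((hbad1 v).2 hp), Finset.card_insert_of_notMem hcA,
        blockCount_insertBlock hcA hg hv, edgeCount_insert hc, pow_add X, hK, hψ, ← mul_assoc]
      congr 2
      · rw [show A.card + 1 + (blockCount g + 1) = A.card + blockCount g + 2 by ring, pow_add]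
        simp
      · congr 1
        refine edgeCount_congr fun x hx y hy => ?_
        rw [insertBlock_of_ne g v (hneA x hx), insertBlock_of_ne g v (hneA y hy)]
        split_ifs <;> omega
      · congr 1
        ext w
        simp only [Finset.mem_filter]
        refine and_congr_right fun hw => ?_
        rw [insertBlock_self, insertBlock_of_ne g v (hNA w hw).2.1]
        split_ifs <;> omega
    -- One more vertex without a new block flips the sign. Expressing the forbidden blocks as a
    -- correction term lets `-ψ v` cancel the matching term of `e1` for every old block.
    have e2 : ∀ v ∈ Finset.Icc 1 (blockCount g),
        (if ∀ x ∈ insert c A, ∀ y ∈ insert c A, G.Adj x y →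
            Function.update g c v x ≠ Function.update g c v y then
          (-1 : ℚ[X]) ^ ((insert c A).card + blockCount (Function.update g c v)) *
            X ^ edgeCount G (· < ·) (insert c A) (Function.update g c v) else 0) =
          K * ((if ∃ w ∈ N, g w = v then ψ v else 0) - ψ v) := by
      intro v hv
      by_cases hv' : ∃ w ∈ N, g w = v
      · rw [if_neg fun h => ((hbad2 v).1 h).2 hv', if_pos hv']
        ring
      rw [if_pos ((hbad2 v).2 ⟨hp, hv'⟩), if_neg hv', Finset.card_insert_of_notMem hcA,
        blockCount_update hcA hg hv, edgeCount_insert hc, pow_add X, hK, hψ, zero_sub, mul_neg,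
        ← neg_mul, ← neg_mul, ← mul_assoc]
      congr 2
      · rw [show A.card + 1 + blockCount g = A.card + blockCount g + 1 by ring, pow_succ]
        simp
      · congr 1
        refine edgeCount_congr fun x hx y hy => ?_
        simp [hneA x hx, hneA y hy]
      · congr 1
        ext w
        simp only [Finset.mem_filter]
        refine and_congr_right fun hw => ?_
        have : g w ≠ v := fun h => hv' ⟨w, hw, h⟩
        simp [(hNA w hw).2.1]
        omega
    rw [Finset.sum_congr rfl e1, Finset.sum_congr rfl e2, if_pos hp, ← Finset.mul_sum,
      ← Finset.mul_sum, ← mul_add, mul_comm _ K, Finset.sum_sub_distrib,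
      Finset.sum_Icc_succ_top (by omega),
      sum_ite_exists_eq N hinj (fun w hw => Finset.mem_Icc.2
        ⟨pos_of_mem_packed hg (hNA w hw).1, le_blockCount g w⟩), tNumber_one_add,
      ← sum_X_pow_card_le_of_injOn N hinj]
    -- The uncancelled last position lies after all blocks and gains no ascent.
    have : ψ (blockCount g + 1) = 1 := by
      simp only [hψ]
      rw [Finset.filter_false_of_mem, Finset.card_empty, pow_zero]
      intro w _
      have := le_blockCount g w
      omega
    rw [this]
    ring

open Classical in
/-- The generating function for columns factors. -/
theorem sum_columns {G : SimpleGraph α} {lt : α → α → Prop}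
    (hnat : ∀ x y, lt x y → x < y) (htrans : ∀ x y z, lt x y → lt y z → lt x z)
    (hadj : ∀ x y, x ≠ y → (G.Adj x y ↔ ¬ lt x y ∧ ¬ lt y x))
    (hG : ∀ c x y, c < x → c < y → x ≠ y → G.Adj c x → G.Adj c y → G.Adj x y) (A : Finset α) :
    ∑ f ∈ packedFunctions A, (if Set.InjOn f A ∧ ∀ x ∈ A, ∀ y ∈ A, f y = f x + 1 → ¬ lt y x then
        (X : ℚ[X]) ^ edgeCount G (fun i j => j < i) A f else 0) =
      ∏ v ∈ A, tNumber (1 + ((neighborsIn G A v).filter fun w => v < w).card) := by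
  induction A using Finset.induction_on_min with
  | empty => simp [packedFunctions_empty, edgeCount]
  | insert c A hc ih =>
    have hcA : c ∉ A := fun h => lt_irrefl c (hc c h)
    rw [prod_insert_min hc, ← ih, sum_packedFunctions_insert hcA, Finset.mul_sum]
    refine Finset.sum_congr rfl fun g hg => ?_
    set N := neighborsIn G A c with hN
    have hNA : ∀ w ∈ N, w ∈ A ∧ w ≠ c ∧ G.Adj c w := fun w hw =>
      ⟨(mem_neighborsIn.1 hw).1, (hc w (mem_neighborsIn.1 hw).1).ne', (mem_neighborsIn.1 hw).2⟩
    have hneA : ∀ w ∈ A, w ≠ c := fun w hw => (hc w hw).ne'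
    -- Every existing position is occupied already, so `c` cannot join one in a column.
    have hupd : ∀ v ∈ Finset.Icc 1 (blockCount g),
        ¬ Set.InjOn (Function.update g c v) (insert c A : Finset α) := by
      intro v hv h
      rw [Finset.mem_Icc] at hv
      obtain ⟨b, hb⟩ := exists_eq_of_mem_packedFunctions hg hv.1 hv.2
      have hbA := mem_of_pos_of_mem_packed hg (x := b) (by omega)
      refine hneA b hbA (h (Finset.mem_coe.2 (Finset.mem_insert_of_mem hbA))
        (Finset.mem_coe.2 (Finset.mem_insert_self c A)) ?_)
      simp [hneA b hbA, hb]
    -- Being least, `c` is never `lt`-above another entry, so it can violate the column condition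
    -- only against the entry directly above it; there the condition says that this entry is a
    -- neighbour of `c`.
    have hval : ∀ v, 1 ≤ v → ((Set.InjOn (insertBlock g c v) (insert c A : Finset α) ∧
        ∀ x ∈ insert c A, ∀ y ∈ insert c A,
          insertBlock g c v y = insertBlock g c v x + 1 → ¬ lt y x) ↔
        (Set.InjOn g A ∧ ∀ x ∈ A, ∀ y ∈ A, g y = g x + 1 → ¬ lt y x) ∧
          ∀ w ∈ A, g w + 1 = v → w ∈ N) := by
      intro v hv1
      constructor
      · rintro ⟨hi, hv⟩
        have hN' : ∀ w ∈ A, g w + 1 = v → w ∈ N := by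
          intro w hw hwv
          refine mem_neighborsIn.2 ⟨hw, (hadj c w (hneA w hw).symm).2 ⟨?_, fun h => ?_⟩⟩
          · refine hv w (Finset.mem_insert_of_mem hw) c (Finset.mem_insert_self _ _) ?_
            rw [insertBlock_self, insertBlock_of_ne g v (hneA w hw), if_neg (by omega), hwv]
          · exact (hc w hw).not_gt (hnat _ _ h)
        refine ⟨⟨?_, ?_⟩, hN'⟩
        · intro x hx y hy hxy
          refine hi (Finset.mem_coe.2 (Finset.mem_insert_of_mem hx))
            (Finset.mem_coe.2 (Finset.mem_insert_of_mem hy)) ?_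
          rw [insertBlock_of_ne g v (hneA x hx), insertBlock_of_ne g v (hneA y hy), hxy]
        · intro x hx y hy hxy
          -- In this case `x` and `y` become consecutive only once `c` is removed from between them.
          -- If `lt y x`, then either `y` is a neighbour of `c`, against the clique property, or `lt
          -- c y`, whence `lt c x` by transitivity, although `x` is a neighbour of `c`.
          by_cases hxv : g x + 1 = v
          · intro hyx
            have hxN := (hNA x (hN' x hx hxv)).2.2
            have h1 := (hadj c x (hneA x hx).symm).1 hxN
            by_cases hcy : G.Adj c y
            · have hne : x ≠ y := by rintro rfl; omega
              exact ((hadj x y hne).1 (hG c x y (hc x hx) (hc y hy) hne hxN hcy)).2 hyx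
            · rw [hadj c y (hneA y hy).symm, not_and_or, not_not, not_not] at hcy
              rcases hcy with h | h
              · exact h1.1 (htrans _ _ _ h hyx)
              · exact (hc y hy).not_gt (hnat _ _ h)
          · refine hv x (Finset.mem_insert_of_mem hx) y (Finset.mem_insert_of_mem hy) ?_
            rw [insertBlock_of_ne g v (hneA x hx), insertBlock_of_ne g v (hneA y hy)]
            split_ifs <;> omega
      · rintro ⟨⟨hi, hv⟩, hw⟩
        constructor
        · intro x hx y hy hxy
          rcases Finset.mem_insert.1 (Finset.mem_coe.1 hx) with rfl | hx' <;>
            rcases Finset.mem_insert.1 (Finset.mem_coe.1 hy) with rfl | hy'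
          · rfl
          · rw [insertBlock_self] at hxy
            exact absurd hxy.symm (insertBlock_ne g v (hneA y hy'))
          · rw [insertBlock_self] at hxy
            exact absurd hxy (insertBlock_ne g v (hneA x hx'))
          · rw [insertBlock_of_ne g v (hneA x hx'), insertBlock_of_ne g v (hneA y hy')] at hxy
            refine hi hx' hy' ?_
            split_ifs at hxy <;> omega
        · intro x hx y hy hxy
          rcases Finset.mem_insert.1 hx with rfl | hx' <;>
            rcases Finset.mem_insert.1 hy with rfl | hy'
          · omega
          · exact fun h => (hc y hy').not_gt (hnat _ _ h)
          · rw [insertBlock_self, insertBlock_of_ne g v (hneA x hx')] at hxy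
            have hxv : g x + 1 = v := by split_ifs at hxy <;> omega
            exact ((hadj y x (hneA x hx').symm).1 (hNA x (hw x hx' hxv)).2.2).1
          · rw [insertBlock_of_ne g v (hneA x hx'), insertBlock_of_ne g v (hneA y hy')] at hxy
            refine hv x hx' y hy' ?_
            split_ifs at hxy <;> omega
    rw [Finset.sum_eq_zero (s := Finset.Icc 1 (blockCount g))
      (fun v hv => if_neg fun h => hupd v hv h.1), add_zero]
    by_cases hp : Set.InjOn g A ∧ ∀ x ∈ A, ∀ y ∈ A, g y = g x + 1 → ¬ lt y x
    swap
    · rw [if_neg hp, mul_zero]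
      refine Finset.sum_eq_zero fun v hv => if_neg fun h => hp ?_
      exact ((hval v (Finset.mem_Icc.1 hv).1).1 h).1
    have hinj : Set.InjOn g N := hp.1.mono fun w hw => (hNA w hw).1
    -- An inversion of `c` is a neighbour placed above it. For `c` at position `v` these are the
    -- neighbours with `g w ≤ v - 1`, so `ψ` is used at `v - 1`.
    set ψ : ℕ → ℚ[X] := fun v => X ^ (N.filter fun w => g w ≤ v).card with hψ
    have e1 : ∀ v ∈ Finset.Icc 1 (blockCount g + 1),
        (if Set.InjOn (insertBlock g c v) (insert c A : Finset α) ∧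
          ∀ x ∈ insert c A, ∀ y ∈ insert c A,
          insertBlock g c v y = insertBlock g c v x + 1 → ¬ lt y x then
          (X : ℚ[X]) ^ edgeCount G (fun i j => j < i) (insert c A) (insertBlock g c v) else 0) =
        X ^ edgeCount G (fun i j => j < i) A g *
          if ∀ w ∈ A, g w + 1 = v → w ∈ N then ψ (v - 1) else 0 := by
      intro v hv
      have hv1 := (Finset.mem_Icc.1 hv).1
      by_cases h : ∀ w ∈ A, g w + 1 = v → w ∈ N
      · rw [if_pos h, if_pos ((hval v hv1).2 ⟨hp, h⟩), edgeCount_insert hc, pow_add, hψ]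
        congr 2
        · refine edgeCount_congr fun x hx y hy => ?_
          rw [insertBlock_of_ne g v (hneA x hx), insertBlock_of_ne g v (hneA y hy)]
          split_ifs <;> omega
        · congr 1
          ext w
          simp only [Finset.mem_filter]
          refine and_congr_right fun hw => ?_
          rw [insertBlock_self, insertBlock_of_ne g v (hNA w hw).2.1]
          split_ifs <;> omega
      · rw [if_neg h, if_neg fun h' => h ((hval v hv1).1 h').2, mul_zero]
    rw [Finset.sum_congr rfl e1, if_pos hp, ← Finset.mul_sum, mul_comm]
    congr 1
    -- The top position is always admissible and gives the summand 1. The order dual enters because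
    -- the exponents now count smaller values instead of larger ones.
    rw [← Finset.add_sum_Ioc_eq_sum_Icc (by omega), tNumber_one_add,
      ← sum_X_pow_card_le_of_injOn (β := ℕᵒᵈ) N (g := fun w => OrderDual.toDual (g w)) hinj]
    have h1 : ∀ w ∈ A, g w + 1 = 1 → w ∈ N := by
      intro w hw h
      have := pos_of_mem_packed hg hw
      omega
    rw [if_pos h1]
    congr 1
    · simp only [hψ]
      rw [Finset.filter_false_of_mem, Finset.card_empty, pow_zero]
      intro w hw
      have := pos_of_mem_packed hg (hNA w hw).1
      omega
    · simp only [OrderDual.toDual_le_toDual]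
      rw [← sum_ite_exists_eq N hinj (s := Finset.Icc 1 (blockCount g)) (fun w hw => Finset.mem_Icc.2
        ⟨pos_of_mem_packed hg (hNA w hw).1, le_blockCount g w⟩) ψ]
      refine (Finset.sum_bij (fun v _ => v + 1) ?_ ?_ ?_ ?_).symm
      · intro v hv
        simp only [Finset.mem_Icc, Finset.mem_Ioc] at hv ⊢
        omega
      · intro v _ v' _ h
        omega
      · intro v hv
        simp only [Finset.mem_Ioc] at hv
        exact ⟨v - 1, Finset.mem_Icc.2 (by omega), by omega⟩
      · intro v hv
        rw [Finset.mem_Icc] at hv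
        have : (∃ w ∈ N, g w = v) ↔ ∀ w ∈ A, g w + 1 = v + 1 → w ∈ N := by
          constructor
          · rintro ⟨w, hw, rfl⟩ w' hw' h
            have : w' = w := hp.1 hw' (hNA w hw).1 (by omega)
            exact this ▸ hw
          · intro h
            obtain ⟨b, hb⟩ := exists_eq_of_mem_packedFunctions hg hv.1 hv.2
            exact ⟨b, h b (mem_of_pos_of_mem_packed hg (by omega)) (by omega), hb⟩
        simp only [this, Nat.add_sub_cancel]

end InsertMin

/-! ### Functions with a given content -/

section Content

set_option linter.unusedSectionVars false

variable {α : Type*} [Fintype α] [DecidableEq α]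

/-- The exponent vector counting how often each value is attained. -/
noncomputable def valueContent (κ : α → ℕ) : ℕ →₀ ℕ := ∑ a, Finsupp.single (κ a) 1

theorem valueContent_apply (κ : α → ℕ) (k : ℕ) :
    valueContent κ k = (Finset.univ.filter fun a => κ a = k).card := by
  simp [valueContent, Finsupp.finsetSum_apply, Finsupp.single_apply]

theorem valueContent_ne_zero {κ : α → ℕ} {k : ℕ} : valueContent κ k ≠ 0 ↔ ∃ a, κ a = k := by
  rw [valueContent_apply, Finset.card_ne_zero]
  simp [Finset.Nonempty]

theorem degree_valueContent (κ : α → ℕ) : (valueContent κ).degree = Fintype.card α := by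
  simp [valueContent]

/-- The functions with content `d`. -/
noncomputable def withContent (α : Type*) [Fintype α] [DecidableEq α] (d : ℕ →₀ ℕ) :
    Finset (α → ℕ) :=
  (Fintype.piFinset fun _ => d.support).filter fun κ => valueContent κ = d

theorem mem_withContent {κ : α → ℕ} {d : ℕ →₀ ℕ} : κ ∈ withContent α d ↔ valueContent κ = d := by
  refine Finset.mem_filter.trans (and_iff_right_of_imp ?_)
  rintro rfl
  rw [Fintype.mem_piFinset]
  intro a
  rw [Finsupp.mem_support_iff, valueContent_ne_zero]
  exact ⟨a, rfl⟩

/-- The exponent vectors of degree `n` whose support is an initial segment. -/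
noncomputable def packedExponents (n : ℕ) : Finset (ℕ →₀ ℕ) :=
  (Finset.finsuppAntidiag (Finset.range n) n).filter fun d =>
    ∀ k ∈ Finset.range n, d (k + 1) ≠ 0 → d k ≠ 0

theorem mem_packedExponents {n : ℕ} {d : ℕ →₀ ℕ} (hd : d ∈ packedExponents n) :
    d.degree = n ∧ ∀ k, d (k + 1) ≠ 0 → d k ≠ 0 := by
  rw [packedExponents, Finset.mem_filter, Finset.mem_finsuppAntidiag] at hd
  obtain ⟨⟨h1, h2⟩, h3⟩ := hd
  refine ⟨?_, fun k hk => ?_⟩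
  · rw [← h1, Finsupp.degree_apply]
    exact Finset.sum_subset h2 fun i _ hi => Finsupp.notMem_support_iff.1 hi
  · have := h2 (Finsupp.mem_support_iff.2 hk)
    rw [Finset.mem_range] at this
    exact h3 k (Finset.mem_range.2 (by omega)) hk

theorem support_valueContent_sub_one {f : α → ℕ} (hf : f ∈ packedFunctions Finset.univ) :
    (valueContent fun a => f a - 1).support = Finset.range (blockCount f) := by
  ext k
  rw [Finsupp.mem_support_iff, valueContent_ne_zero, Finset.mem_range]
  have h0 := (mem_packedFunctions.1 hf).1
  constructor
  · rintro ⟨a, rfl⟩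
    have h1 := le_blockCount f a
    have h2 : f a ≠ 0 := fun h => by simpa using (h0 a).1 h
    omega
  · intro hk
    obtain ⟨b, hb⟩ := exists_eq_of_mem_packedFunctions hf (k := k + 1) (by omega) (by omega)
    exact ⟨b, by omega⟩

theorem valueContent_sub_one_mem {f : α → ℕ} (hf : f ∈ packedFunctions Finset.univ) :
    (valueContent fun a => f a - 1) ∈ packedExponents (Fintype.card α) := by
  have hs := support_valueContent_sub_one hf
  have hcard : blockCount f ≤ Fintype.card α := by
    rw [← Finset.card_range (blockCount f), ← hs]
    refine le_trans (Finset.card_le_card (t := Finset.univ.image fun a => f a - 1) ?_)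
      Finset.card_image_le
    intro k hk
    rw [Finsupp.mem_support_iff, valueContent_ne_zero] at hk
    simpa using hk
  have hsub : (valueContent fun a => f a - 1).support ⊆ Finset.range (Fintype.card α) := by
    rw [hs]
    exact Finset.range_subset_range.2 hcard
  rw [packedExponents, Finset.mem_filter, Finset.mem_finsuppAntidiag]
  refine ⟨⟨?_, hsub⟩, fun k _ hk => ?_⟩
  · refine (Finset.sum_subset hsub fun i _ hi => Finsupp.notMem_support_iff.1 hi).symm.trans ?_
    rw [← Finsupp.degree_apply, degree_valueContent]
  · rw [← Finsupp.mem_support_iff, hs, Finset.mem_range] at hk ⊢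
    omega

theorem add_one_mem_packedFunctions {d : ℕ →₀ ℕ} {n : ℕ} (hd : d ∈ packedExponents n) {κ : α → ℕ}
    (hκ : valueContent κ = d) : (fun a => κ a + 1) ∈ packedFunctions Finset.univ := by
  have hd' := (mem_packedExponents hd).2
  have key : ∀ m k, k ≤ m → d m ≠ 0 → d k ≠ 0 := by
    intro m
    induction m with
    | zero => intro k hk h; rwa [Nat.le_zero.1 hk]
    | succ m ih =>
      intro k hk h
      rcases hk.eq_or_lt with rfl | hk
      · exact h
      · exact ih k (by omega) (hd' m h)
  refine mem_packedFunctions.2 ⟨fun a => by simp, fun a k h1 hk => ?_⟩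
  have h2 : d (k - 1) ≠ 0 := by
    refine key (κ a) (k - 1) (by omega) ?_
    rw [← hκ, valueContent_ne_zero]
    exact ⟨a, rfl⟩
  rw [← hκ, valueContent_ne_zero] at h2
  obtain ⟨b, hb⟩ := h2
  exact ⟨b, by omega⟩

variable {R : Type*} [CommRing R]

/-- The alternating sum of the coefficients of degree `n` at the packed exponents. On symmetric
functions this is the coefficient of the Schur function of the column `1 ^ n`. -/
noncomputable def alternatingCoeff (n : ℕ) : MvPowerSeries ℕ R →ₗ[R] R :=
  ∑ d ∈ packedExponents n, (-1 : R) ^ (n + d.support.card) • MvPowerSeries.coeff d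

theorem alternatingCoeff_apply (n : ℕ) (f : MvPowerSeries ℕ R) :
    alternatingCoeff n f =
      ∑ d ∈ packedExponents n, (-1) ^ (n + d.support.card) * MvPowerSeries.coeff d f := by
  simp [alternatingCoeff, LinearMap.sum_apply]

/-- Functions whose content is a packed exponent are the packed functions lowered by one: colours
start at 0, whereas a packed function reserves 0 for points outside its set. The size of the support
becomes the number of blocks. -/
theorem alternatingCoeff_eq_sum_packedFunctions {f : MvPowerSeries ℕ R} {w : (α → ℕ) → R}
    (hf : ∀ d, MvPowerSeries.coeff d f = ∑ κ ∈ withContent α d, w κ) :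
    alternatingCoeff (Fintype.card α) f = ∑ g ∈ packedFunctions (Finset.univ : Finset α),
      (-1) ^ (Fintype.card α + blockCount g) * w (fun a => g a - 1) := by
  rw [alternatingCoeff_apply, ← Finset.sum_fiberwise_of_maps_to (fun g => valueContent_sub_one_mem)]
  refine Finset.sum_congr rfl fun d hd => ?_
  rw [hf, Finset.mul_sum]
  refine (Finset.sum_bij' (fun g _ => fun a => g a - 1) (fun κ _ => fun a => κ a + 1)
    ?_ ?_ ?_ ?_ ?_).symm
  · intro g hg
    exact mem_withContent.2 (Finset.mem_filter.1 hg).2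
  · intro κ hκ
    rw [mem_withContent] at hκ
    exact Finset.mem_filter.2 ⟨add_one_mem_packedFunctions hd hκ, by simpa using hκ⟩
  · intro g hg
    funext a
    have h0 := (mem_packedFunctions.1 (Finset.mem_filter.1 hg).1).1 a
    have h2 : g a ≠ 0 := fun h => by simpa using h0.1 h
    simp only
    omega
  · intro κ _
    simp
  · intro g hg
    rw [Finset.mem_filter] at hg
    rw [← hg.2, support_valueContent_sub_one hg.1, Finset.card_range]

end Content

/-! ### Schur functions as sums over fillings -/

section Schur

/-- The fillings of the cells of `μ` that are semistandard. -/
def IsSemistandard {μ : YoungDiagram} (κ : {c // c ∈ μ.cells} → ℕ) : Prop :=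
  (∀ x y, x.1.1 = y.1.1 → x.1.2 < y.1.2 → κ x ≤ κ y) ∧
    ∀ x y, x.1.2 = y.1.2 → x.1.1 < y.1.1 → κ x < κ y

/-- Semistandard Young tableaux are semistandard fillings of the cells. -/
def tableauEquivFilling (μ : YoungDiagram) :
    SemistandardYoungTableau μ ≃ {κ : {c // c ∈ μ.cells} → ℕ // IsSemistandard κ} where
  toFun T := ⟨fun c => T c.1.1 c.1.2,
    fun x y h h' => by simpa [h] using T.row_weak h' (show (x.1.1, y.1.2) ∈ μ by rw [h]; exact y.2),
    fun x y h h' => by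
      simpa [h] using T.col_strict h' (show (y.1.1, x.1.2) ∈ μ by rw [h]; exact y.2)⟩
  invFun κ :=
    { entry := fun i j => if h : (i, j) ∈ μ.cells then κ.1 ⟨(i, j), h⟩ else 0
      row_weak' := by
        intro i j₁ j₂ h hc
        have hc' : (i, j₁) ∈ μ := μ.up_left_mem le_rfl h.le hc
        rw [← YoungDiagram.mem_cells] at hc hc'
        rw [dif_pos hc, dif_pos hc']
        exact κ.2.1 _ _ rfl h
      col_strict' := by
        intro i₁ i₂ j h hc
        have hc' : (i₁, j) ∈ μ := μ.up_left_mem h.le le_rfl hc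
        rw [← YoungDiagram.mem_cells] at hc hc'
        rw [dif_pos hc, dif_pos hc']
        exact κ.2.2 _ _ rfl h
      zeros' := by
        intro i j h
        exact dif_neg h }
  left_inv T := by
    ext i j
    change (if h : (i, j) ∈ μ.cells then T i j else 0) = T i j
    split_ifs with h
    · rfl
    · exact (T.zeros h).symm
  right_inv κ := by
    apply Subtype.ext
    funext c
    change (if h : (c.1.1, c.1.2) ∈ μ.cells then κ.1 ⟨(c.1.1, c.1.2), h⟩ else 0) = κ.1 c
    rw [dif_pos c.2]

theorem tableauContent_eq {μ : YoungDiagram} (T : SemistandardYoungTableau μ) :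
    tableauContent T = valueContent (tableauEquivFilling μ T).1 := by
  rw [tableauContent, valueContent, ← Finset.sum_coe_sort]
  rfl

variable {R : Type*} [CommRing R]

open Classical in
theorem coeff_schurFunction (μ : YoungDiagram) (d : ℕ →₀ ℕ) :
    MvPowerSeries.coeff d (schurFunction R μ) =
      ∑ κ ∈ withContent {c // c ∈ μ.cells} d, if IsSemistandard κ then 1 else 0 := by
  rw [Finset.sum_boole]
  change (Nat.card {T : SemistandardYoungTableau μ // tableauContent T = d} : R) = _
  congr 1
  have e : {T : SemistandardYoungTableau μ // tableauContent T = d} ≃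
      {κ // κ ∈ (withContent {c // c ∈ μ.cells} d).filter IsSemistandard} :=
    ((tableauEquivFilling μ).subtypeEquiv (q := fun κ => valueContent κ.1 = d)
      fun T => by rw [tableauContent_eq]).trans
      ((Equiv.subtypeSubtypeEquivSubtypeInter IsSemistandard fun κ => valueContent κ = d).trans
        (Equiv.subtypeEquivRight fun κ => by
          rw [Finset.mem_filter, mem_withContent, and_comm]))
  rw [Nat.card_congr e, Nat.card_eq_fintype_card, Fintype.card_coe]

theorem isSemistandard_sub_one {μ : YoungDiagram} {f : {c // c ∈ μ.cells} → ℕ}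
    (hf : f ∈ packedFunctions Finset.univ) :
    IsSemistandard (fun a => f a - 1) ↔ IsSemistandard f := by
  have hpos : ∀ a, 1 ≤ f a := by
    intro a
    have h0 := (mem_packedFunctions.1 hf).1 a
    have h2 : f a ≠ 0 := fun h => by simpa using h0.1 h
    omega
  unfold IsSemistandard
  refine and_congr ?_ ?_ <;>
  · refine forall₂_congr fun x y => forall₂_congr fun _ _ => ?_
    have := hpos x
    have := hpos y
    dsimp only
    omega

open Classical in
theorem alternatingCoeff_schurFunction (μ : YoungDiagram) :
    alternatingCoeff μ.card (schurFunction R μ) =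
      ∑ f ∈ packedFunctions (Finset.univ : Finset {c // c ∈ μ.cells}),
        if IsSemistandard f then (-1) ^ (μ.card + blockCount f) else 0 := by
  have h := alternatingCoeff_eq_sum_packedFunctions
    (fun d => coeff_schurFunction (R := R) μ d)
  rw [Fintype.card_coe] at h
  refine h.trans (Finset.sum_congr rfl fun f hf => ?_)
  rw [mul_ite, mul_one, mul_zero]
  simp only [isSemistandard_sub_one hf]

/-- Moving the last cell of the first row into the preceding block reverses signs. -/
theorem alternatingCoeff_schurFunction_eq_zero {μ : YoungDiagram} (h : (0, 1) ∈ μ) :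
    alternatingCoeff μ.card (schurFunction R μ) = 0 := by
  classical
  rw [alternatingCoeff_schurFunction]
  have hlen : 1 < μ.rowLen 0 := YoungDiagram.mem_iff_lt_rowLen.1 h
  have hmem : (0, μ.rowLen 0 - 1) ∈ μ.cells :=
    YoungDiagram.mem_iff_lt_rowLen.2 (by omega)
  have hmem' : (0, μ.rowLen 0 - 2) ∈ μ.cells :=
    YoungDiagram.mem_iff_lt_rowLen.2 (by omega)
  set c : {c // c ∈ μ.cells} := ⟨(0, μ.rowLen 0 - 1), hmem⟩ with hc
  set l : {c // c ∈ μ.cells} := ⟨(0, μ.rowLen 0 - 2), hmem'⟩ with hl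
  have hlc : l ≠ c := by
    intro h
    have : μ.rowLen 0 - 2 = μ.rowLen 0 - 1 := congrArg (fun x => x.1.2) h
    omega
  -- The cell `c` has nothing to its right and nothing above it, so it is constrained only by the
  -- cells to its left and those below.
  have hright : ∀ y : {c // c ∈ μ.cells}, c.1.1 = y.1.1 → ¬ c.1.2 < y.1.2 := by
    rintro ⟨⟨i, j⟩, hy⟩ (rfl : 0 = i) (h2 : μ.rowLen 0 - 1 < j)
    have : j < μ.rowLen 0 := YoungDiagram.mem_iff_lt_rowLen.1 hy
    omega
  have huniv : (Finset.univ : Finset {c // c ∈ μ.cells}) = insert c (Finset.univ.erase c) :=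
    (Finset.insert_erase (Finset.mem_univ c)).symm
  have hcA : c ∉ (Finset.univ : Finset {c // c ∈ μ.cells}).erase c := Finset.notMem_erase _ _
  rw [huniv, sum_packedFunctions_insert hcA]
  refine Finset.sum_eq_zero fun g hg => ?_
  have hgl : 1 ≤ g l := by
    have h0 := (mem_packedFunctions.1 hg).1 l
    have : g l ≠ 0 := fun h => h0.1 h (Finset.mem_erase.2 ⟨hlc, Finset.mem_univ _⟩)
    omega
  -- A cell to the left needs a value at most `v`, and a cell below a value above `v`, whether `c`
  -- joins block `v` or forms a new block right after it.
  have key : ∀ v, IsSemistandard (insertBlock g c (v + 1)) ↔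
      IsSemistandard (Function.update g c v) := by
    intro v
    unfold IsSemistandard
    refine and_congr ?_ ?_
    · refine forall₂_congr fun x y => forall₂_congr fun h1 h2 => ?_
      have hx : x ≠ c := by
        rintro rfl
        exact hright y h1 h2
      by_cases hy : y = c
      · subst hy
        rw [insertBlock_self, insertBlock_of_ne g _ hx, Function.update_self,
          Function.update_of_ne hx]
        split_ifs <;> omega
      · rw [insertBlock_of_ne g _ hy, insertBlock_of_ne g _ hx, Function.update_of_ne hy,
          Function.update_of_ne hx]
        split_ifs <;> omega
    · refine forall₂_congr fun x y => forall₂_congr fun h1 h2 => ?_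
      have hy : y ≠ c := by
        rintro rfl
        exact Nat.not_lt_zero _ h2
      by_cases hx : x = c
      · subst hx
        rw [insertBlock_self, insertBlock_of_ne g _ hy, Function.update_self,
          Function.update_of_ne hy]
        split_ifs <;> omega
      · rw [insertBlock_of_ne g _ hy, insertBlock_of_ne g _ hx, Function.update_of_ne hy,
          Function.update_of_ne hx]
        split_ifs <;> omega
  -- The one insertion without a partner puts `c` before every other block, in particular before its
  -- left neighbour `l`.
  have hone : ¬ IsSemistandard (insertBlock g c 1) := by
    intro h
    have := h.1 l c rfl (show μ.rowLen 0 - 2 < μ.rowLen 0 - 1 by omega)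
    rw [insertBlock_self, insertBlock_of_ne g _ hlc, if_pos hgl] at this
    omega
  rw [← Finset.add_sum_Ioc_eq_sum_Icc (by omega), if_neg hone, zero_add,
    ← Finset.sum_bij (s := Finset.Icc 1 (blockCount g))
      (f := fun v => if IsSemistandard (insertBlock g c (v + 1)) then
        (-1 : R) ^ (μ.card + blockCount (insertBlock g c (v + 1))) else 0) (fun v _ => v + 1),
    ← Finset.sum_add_distrib]
  · refine Finset.sum_eq_zero fun v hv => ?_
    rw [blockCount_update hcA hg hv, blockCount_insertBlock hcA hg
      (by rw [Finset.mem_Icc] at hv ⊢; omega)]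
    simp only [key]
    split_ifs
    · rw [← add_assoc, pow_succ]
      ring
    · simp
  · intro v hv
    simp only [Finset.mem_Icc, Finset.mem_Ioc] at hv ⊢
    omega
  · intro v _ v' _ h
    omega
  · intro v hv
    simp only [Finset.mem_Ioc] at hv
    exact ⟨v - 1, Finset.mem_Icc.2 (by omega), by omega⟩
  · intro v _
    rfl

theorem mem_columnShape {n i j : ℕ} : (i, j) ∈ columnShape n ↔ i < n ∧ j = 0 := by
  rw [← YoungDiagram.mem_cells]
  simp [columnShape, eq_comm]

theorem card_columnShape (n : ℕ) : (columnShape n).card = n := by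
  simp [YoungDiagram.card, columnShape]

theorem eq_columnShape {μ : YoungDiagram} (h : (0, 1) ∉ μ) : μ = columnShape μ.card := by
  have h0 : ∀ i j, (i, j) ∈ μ → j = 0 := by
    intro i j hij
    by_contra hj
    exact h (μ.up_left_mem (Nat.zero_le i) (by omega) hij)
  have key : μ = columnShape (μ.colLen 0) := by
    ext ⟨i, j⟩
    rw [YoungDiagram.mem_cells, YoungDiagram.mem_cells, mem_columnShape,
      ← YoungDiagram.mem_iff_lt_colLen]
    constructor
    · intro hij
      have := h0 i j hij
      subst this
      exact ⟨hij, rfl⟩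
    · rintro ⟨h, rfl⟩
      exact h
  have h1 : μ.card = μ.colLen 0 := by
    conv_lhs => rw [key]
    exact card_columnShape _
  rw [h1]
  exact key

theorem isSemistandard_columnShape_iff {n : ℕ} {f : {c // c ∈ (columnShape n).cells} → ℕ} :
    f ∈ packedFunctions Finset.univ ∧ IsSemistandard f ↔ f = fun x => x.1.1 + 1 := by
  have hcol : ∀ x : {c // c ∈ (columnShape n).cells}, x.1.1 < n ∧ x.1.2 = 0 := fun x =>
    mem_columnShape.1 x.2
  have hext : ∀ x y : {c // c ∈ (columnShape n).cells}, x.1.1 = y.1.1 → x = y := fun x y h =>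
    Subtype.ext (Prod.ext h ((hcol x).2.trans (hcol y).2.symm))
  constructor
  · rintro ⟨hf, -, hf'⟩
    have key : ∀ m, ∀ x : {c // c ∈ (columnShape n).cells}, x.1.1 = m → f x = m + 1 := by
      intro m
      induction m using Nat.strong_induction_on with
      | _ m ih =>
        intro x hx
        have h1 : m + 1 ≤ f x := by
          rcases Nat.eq_zero_or_pos m with rfl | hm
          · have h0 := (mem_packedFunctions.1 hf).1 x
            have : f x ≠ 0 := fun h => by simpa using h0.1 h
            omega
          · have hmem : (m - 1, 0) ∈ (columnShape n).cells :=
              mem_columnShape.2 ⟨by have := (hcol x).1; omega, rfl⟩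
            have h2 := hf' ⟨_, hmem⟩ x (hcol x).2.symm (show m - 1 < x.1.1 by omega)
            rw [ih (m - 1) (by omega) ⟨_, hmem⟩ rfl] at h2
            omega
        by_contra hne
        -- Packedness forces the value `m + 1` to occur. Cells above row `m` have smaller values by
        -- induction, and cells below have values exceeding `f x`, so it occurs at `x`.
        obtain ⟨b, hb⟩ := (mem_packedFunctions.1 hf).2 x (m + 1) (by omega) h1
        rcases lt_trichotomy b.1.1 x.1.1 with h | h | h
        · have := ih b.1.1 (by omega) b rfl
          omega
        · exact hne (hext b x h ▸ hb)
        · have := hf' x b ((hcol x).2.trans (hcol b).2.symm) h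
          omega
    funext x
    exact key _ x rfl
  · rintro rfl
    refine ⟨mem_packedFunctions.2 ⟨fun a => by simp, fun a k h1 hk => ?_⟩, fun x y h _ => by simp [h],
      fun x y _ h => by simpa using h⟩
    have hmem : (k - 1, 0) ∈ (columnShape n).cells :=
      mem_columnShape.2 ⟨by have := (hcol a).1; omega, rfl⟩
    exact ⟨⟨_, hmem⟩, by simp only; omega⟩

theorem alternatingCoeff_schurFunction_columnShape (n : ℕ) :
    alternatingCoeff n (schurFunction R (columnShape n)) = 1 := by
  classical
  have h := alternatingCoeff_schurFunction (R := R) (columnShape n)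
  rw [card_columnShape] at h
  have hf : ((packedFunctions (Finset.univ : Finset {c // c ∈ (columnShape n).cells})).filter
      fun f => IsSemistandard f) = {fun x => x.1.1 + 1} := by
    ext f
    rw [Finset.mem_filter, isSemistandard_columnShape_iff, Finset.mem_singleton]
  have hb : blockCount (fun x : {c // c ∈ (columnShape n).cells} => x.1.1 + 1) = n := by
    refine blockCount_eq (fun a => (mem_columnShape.1 a.2).1) fun hn => ?_
    have hmem : (n - 1, 0) ∈ (columnShape n).cells := mem_columnShape.2 ⟨by omega, rfl⟩
    exact ⟨⟨_, hmem⟩, by simp only; omega⟩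
  rw [h, ← Finset.sum_filter, hf, Finset.sum_singleton, hb, ← two_mul, pow_mul, neg_one_sq, one_pow]

theorem degree_tableauContent {μ : YoungDiagram} (T : SemistandardYoungTableau μ) :
    (tableauContent T).degree = μ.card := by
  rw [tableauContent_eq, degree_valueContent, Fintype.card_coe]

theorem coeff_schurFunction_eq_zero {μ : YoungDiagram} {d : ℕ →₀ ℕ} (h : d.degree ≠ μ.card) :
    MvPowerSeries.coeff d (schurFunction R μ) = 0 := by
  change (Nat.card {T : SemistandardYoungTableau μ // tableauContent T = d} : R) = 0
  have : IsEmpty {T : SemistandardYoungTableau μ // tableauContent T = d} :=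
    ⟨fun T => h (by rw [← T.2, degree_tableauContent])⟩
  simp

/-- Extraction of the coefficient of `s_{1 ^ n}` from a Schur expansion. -/
theorem alternatingCoeff_of_isSchurExpansion {f : MvPowerSeries ℕ R} {c : YoungDiagram →₀ R}
    (h : IsSchurExpansion f c) (n : ℕ) : alternatingCoeff n f = c (columnShape n) := by
  classical
  rw [h, Finsupp.sum, map_sum]
  have key : ∀ μ : YoungDiagram, alternatingCoeff n (schurFunction R μ) =
      if μ = columnShape n then 1 else 0 := by
    intro μ
    split_ifs with hμ
    · rw [hμ, alternatingCoeff_schurFunction_columnShape]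
    · by_cases hn : μ.card = n
      · subst hn
        refine alternatingCoeff_schurFunction_eq_zero ?_
        by_contra h1
        exact hμ (eq_columnShape h1)
      · rw [alternatingCoeff_apply]
        refine Finset.sum_eq_zero fun d hd => ?_
        rw [coeff_schurFunction_eq_zero, mul_zero]
        rw [(mem_packedExponents hd).1]
        exact Ne.symm hn
  simp only [map_smul, key, smul_eq_mul, mul_ite, mul_one, mul_zero]
  rw [Finset.sum_ite_eq']
  split_ifs with hc
  · rfl
  · exact (Finsupp.notMem_support_iff.1 hc).symm

end Schur

/-! ### Symmetry of the chromatic quasisymmetric function -/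

/-- Invariance of the coefficients under adjacent transpositions of the variables. -/
def IsSwapInvariant {R : Type*} [CommSemiring R] (f : MvPowerSeries ℕ R) : Prop :=
  ∀ (i : ℕ) (d : ℕ →₀ ℕ), MvPowerSeries.coeff (d.equivMapDomain (Equiv.swap i (i + 1))) f =
    MvPowerSeries.coeff d f

/-! ### Two-colourings: exchanging the sizes of the colour classes -/

section TwoColorings

variable {α : Type*} [LinearOrder α] {R : Type*} [CommRing R]

/-- The indicator function of `S`. -/
def indicatorColoring (S : Finset α) : α → ℕ := fun v => if v ∈ S then 1 else 0

theorem indicatorColoring_insert_self (S : Finset α) (a : α) :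
    indicatorColoring (insert a S) a = 1 := by
  simp [indicatorColoring]

theorem indicatorColoring_insert_of_ne (S : Finset α) {a v : α} (h : v ≠ a) :
    indicatorColoring (insert a S) v = indicatorColoring S v := by
  simp [indicatorColoring, h]

theorem indicatorColoring_of_notMem {S : Finset α} {v : α} (h : v ∉ S) :
    indicatorColoring S v = 0 := by
  simp [indicatorColoring, h]

open Classical in
/-- The weight `t ^ asc` of the two-colouring of `W` whose larger colour class is `S`. -/
noncomputable def twoColorWeight (G : SimpleGraph α) (t : R) (W S : Finset α) : R :=
  if ∀ u ∈ W, ∀ v ∈ W, G.Adj u v → indicatorColoring S u ≠ indicatorColoring S v then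
    t ^ edgeCount G (· < ·) W (indicatorColoring S) else 0

-- The least vertex `a` with the smaller colour forces the larger colour on its neighbours, and each
-- of its edges is an ascent; with the larger colour it forces the smaller one, and none of its
-- edges is an ascent.
open Classical in
theorem twoColorWeight_insert {G : SimpleGraph α} (t : R) {W S : Finset α} {a : α}
    (ha : ∀ w ∈ W, a < w) (hS : S ⊆ W) :
    twoColorWeight G t (insert a W) S =
      (if ∀ w ∈ neighborsIn G W a, w ∈ S then t ^ (neighborsIn G W a).card else 0) *
        twoColorWeight G t W S ∧
    twoColorWeight G t (insert a W) (insert a S) =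
      (if ∀ w ∈ neighborsIn G W a, w ∉ S then 1 else 0) * twoColorWeight G t W S := by
  have haW : a ∉ W := fun h => lt_irrefl a (ha a h)
  have haS : a ∉ S := fun h => haW (hS h)
  have hne : ∀ w ∈ W, w ≠ a := fun w hw => (ha w hw).ne'
  have h01 : ∀ w, indicatorColoring S w = 0 ∨ indicatorColoring S w = 1 := by
    intro w; unfold indicatorColoring; split_ifs <;> simp
  have h1 : ∀ w, indicatorColoring S w = 1 ↔ w ∈ S := by
    intro w; unfold indicatorColoring; split_ifs with h <;> simp [h]
  have hcong : edgeCount G (· < ·) W (indicatorColoring (insert a S)) =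
      edgeCount G (· < ·) W (indicatorColoring S) := by
    refine edgeCount_congr fun x hx y hy => ?_
    rw [indicatorColoring_insert_of_ne S (hne x hx), indicatorColoring_insert_of_ne S (hne y hy)]
  have hprop : ∀ f : α → ℕ, (∀ u ∈ insert a W, ∀ v ∈ insert a W, G.Adj u v → f u ≠ f v) ↔
      (∀ w ∈ neighborsIn G W a, f w ≠ f a) ∧ ∀ u ∈ W, ∀ v ∈ W, G.Adj u v → f u ≠ f v := by
    intro f
    constructor
    · intro h
      refine ⟨fun w hw => ?_, fun u hu v hv => h u (Finset.mem_insert_of_mem hu) v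
        (Finset.mem_insert_of_mem hv)⟩
      rw [mem_neighborsIn] at hw
      exact h w (Finset.mem_insert_of_mem hw.1) a (Finset.mem_insert_self _ _) hw.2.symm
    · rintro ⟨h, h'⟩ u hu v hv huv
      rcases Finset.mem_insert.1 hu with rfl | hu' <;> rcases Finset.mem_insert.1 hv with rfl | hv'
      · exact absurd huv G.irrefl
      · exact (h v (mem_neighborsIn.2 ⟨hv', huv⟩)).symm
      · exact h u (mem_neighborsIn.2 ⟨hu', huv.symm⟩)
      · exact h' u hu' v hv' huv
  constructor
  · unfold twoColorWeight
    simp only [hprop]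
    have hiff : (∀ w ∈ neighborsIn G W a, indicatorColoring S w ≠ indicatorColoring S a) ↔
        ∀ w ∈ neighborsIn G W a, w ∈ S := by
      refine forall₂_congr fun w _ => ?_
      rw [indicatorColoring_of_notMem haS, ← h1]
      have := h01 w
      omega
    simp only [hiff]
    by_cases hN : ∀ w ∈ neighborsIn G W a, w ∈ S
    · rw [if_pos hN, mul_ite, mul_zero]
      simp only [eq_true hN, true_and]
      split_ifs
      · rw [edgeCount_insert ha, pow_add, mul_comm, Finset.filter_true_of_mem]
        intro w hw
        rw [indicatorColoring_of_notMem haS, (h1 w).2 (hN w hw)]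
        exact one_pos
      · rfl
    · rw [if_neg hN, zero_mul, if_neg fun h => hN h.1]
  · unfold twoColorWeight
    simp only [hprop, hcong, edgeCount_insert ha]
    have hiff : (∀ w ∈ neighborsIn G W a,
        indicatorColoring (insert a S) w ≠ indicatorColoring (insert a S) a) ↔
        ∀ w ∈ neighborsIn G W a, w ∉ S := by
      refine forall₂_congr fun w hw => ?_
      rw [indicatorColoring_insert_self,
        indicatorColoring_insert_of_ne S (hne w (mem_neighborsIn.1 hw).1), ← h1]
    have hiff' : (∀ u ∈ W, ∀ v ∈ W, G.Adj u v →
          indicatorColoring (insert a S) u ≠ indicatorColoring (insert a S) v) ↔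
        ∀ u ∈ W, ∀ v ∈ W, G.Adj u v → indicatorColoring S u ≠ indicatorColoring S v := by
      refine forall₂_congr fun u hu => forall₂_congr fun v hv => ?_
      rw [indicatorColoring_insert_of_ne S (hne u hu), indicatorColoring_insert_of_ne S (hne v hv)]
    simp only [hiff, hiff']
    by_cases hN : ∀ w ∈ neighborsIn G W a, w ∉ S
    · rw [if_pos hN, one_mul]
      simp only [eq_true hN, true_and]
      rw [Finset.filter_false_of_mem, Finset.card_empty, add_zero]
      intro w hw
      rw [indicatorColoring_insert_self,
        indicatorColoring_insert_of_ne S (hne w (mem_neighborsIn.1 hw).1)]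
      have := h01 w
      omega
    · rw [if_neg hN, zero_mul, if_neg fun h => hN h.1]

/-- The generating function of the two-colourings of `W`. -/
noncomputable def twoColorSum (G : SimpleGraph α) (t : R) (W : Finset α) (x y : R) : R :=
  ∑ S ∈ W.powerset, twoColorWeight G t W S * (x ^ (W \ S).card * y ^ S.card)

/-- The part of `twoColorSum` where `b` has the smaller colour. -/
noncomputable def twoColorSumLow (G : SimpleGraph α) (t : R) (W : Finset α) (b : α) (x y : R) : R :=
  ∑ S ∈ W.powerset, if b ∈ S then 0 else twoColorWeight G t W S * (x ^ (W \ S).card * y ^ S.card)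

/-- The part of `twoColorSum` where `b` has the larger colour. -/
noncomputable def twoColorSumHigh (G : SimpleGraph α) (t : R) (W : Finset α) (b : α) (x y : R) : R :=
  ∑ S ∈ W.powerset, if b ∈ S then twoColorWeight G t W S * (x ^ (W \ S).card * y ^ S.card) else 0

theorem twoColorSum_eq (G : SimpleGraph α) (t : R) (W : Finset α) (b : α) (x y : R) :
    twoColorSum G t W x y = twoColorSumLow G t W b x y + twoColorSumHigh G t W b x y := by
  rw [twoColorSum, twoColorSumLow, twoColorSumHigh, ← Finset.sum_add_distrib]
  refine Finset.sum_congr rfl fun S _ => ?_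
  split_ifs <;> simp

open Classical in
theorem twoColorSumLow_insert {G : SimpleGraph α} (t : R) {W : Finset α} {a : α}
    (ha : ∀ w ∈ W, a < w) (x y : R) :
    twoColorSumLow G t (insert a W) a x y = x * ∑ S ∈ W.powerset,
      (if ∀ w ∈ neighborsIn G W a, w ∈ S then t ^ (neighborsIn G W a).card else 0) *
        (twoColorWeight G t W S * (x ^ (W \ S).card * y ^ S.card)) := by
  have haW : a ∉ W := fun h => lt_irrefl a (ha a h)
  rw [twoColorSumLow, Finset.sum_powerset_insert haW, Finset.mul_sum]
  rw [Finset.sum_eq_zero (f := fun S => if a ∈ insert a S then _ else _)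
    (fun S _ => if_pos (Finset.mem_insert_self a S)), add_zero]
  refine Finset.sum_congr rfl fun S hS => ?_
  rw [Finset.mem_powerset] at hS
  have haS : a ∉ S := fun h => haW (hS h)
  rw [if_neg haS, (twoColorWeight_insert t ha hS).1, Finset.insert_sdiff_of_notMem _ haS,
    Finset.card_insert_of_notMem fun h => haW (Finset.mem_sdiff.1 h).1, pow_succ]
  ring

open Classical in
theorem twoColorSumHigh_insert {G : SimpleGraph α} (t : R) {W : Finset α} {a : α}
    (ha : ∀ w ∈ W, a < w) (x y : R) :
    twoColorSumHigh G t (insert a W) a x y = y * ∑ S ∈ W.powerset,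
      (if ∀ w ∈ neighborsIn G W a, w ∉ S then 1 else 0) *
        (twoColorWeight G t W S * (x ^ (W \ S).card * y ^ S.card)) := by
  have haW : a ∉ W := fun h => lt_irrefl a (ha a h)
  rw [twoColorSumHigh, Finset.sum_powerset_insert haW, Finset.mul_sum]
  rw [Finset.sum_eq_zero (s := W.powerset) (f := fun S => if a ∈ S then _ else _)
    (fun S hS => if_neg fun h => haW (Finset.mem_powerset.1 hS h)), zero_add]
  refine Finset.sum_congr rfl fun S hS => ?_
  rw [Finset.mem_powerset] at hS
  have haS : a ∉ S := fun h => haW (hS h)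
  have hsd : insert a W \ insert a S = W \ S := by
    rw [Finset.insert_sdiff_insert, Finset.sdiff_insert_of_notMem haW]
  rw [if_pos (Finset.mem_insert_self a S), (twoColorWeight_insert t ha hS).2, hsd,
    Finset.card_insert_of_notMem haS, pow_succ]
  ring

/-- By `hW`, edges join only consecutive elements of `W`, so the graph on `W` is a disjoint union of
monotone paths. The alternatives reflect the length of the path starting at the least element `b`.
With an odd number of vertices, both colourings of the path have equally many ascents and the
surplus vertex has the colour of `b`; with an even number, the colour classes balance and the
colouring starting low has one ascent more. The symmetric factor `B` collects the rest. -/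
theorem twoColorSum_structure {G : SimpleGraph α} (t : R) (W : Finset α)
    (hW : ∀ u ∈ W, ∀ v ∈ W, ∀ w ∈ W, u < v → v < w → ¬ G.Adj u w) :
    W = ∅ ∨ ∃ b ∈ W, (∀ w ∈ W, b ≤ w) ∧ ∃ B : R → R → R, (∀ x y, B x y = B y x) ∧
      ((∀ x y, twoColorSumLow G t W b x y = x * B x y ∧
          twoColorSumHigh G t W b x y = y * B x y) ∨
        ∀ x y, twoColorSumLow G t W b x y = t * B x y ∧ twoColorSumHigh G t W b x y = B x y) := by
  classical
  induction W using Finset.induction_on_min with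
  | empty => exact Or.inl rfl
  | insert a W ha ih =>
    right
    refine ⟨a, Finset.mem_insert_self _ _, ?_, ?_⟩
    · intro w hw
      rcases Finset.mem_insert.1 hw with rfl | hw
      · exact le_rfl
      · exact (ha w hw).le
    have hsymm : ∀ x y, twoColorSum G t W x y = twoColorSum G t W y x := by
      intro x y
      rcases ih (fun u hu v hv w hw => hW u (Finset.mem_insert_of_mem hu) v
        (Finset.mem_insert_of_mem hv) w (Finset.mem_insert_of_mem hw)) with
        rfl | ⟨b, _, _, B, hB, h | h⟩
      · simp [twoColorSum]
      · rw [twoColorSum_eq G t W b, twoColorSum_eq G t W b, (h x y).1, (h x y).2, (h y x).1,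
          (h y x).2, hB y x]
        ring
      · rw [twoColorSum_eq G t W b, twoColorSum_eq G t W b, (h x y).1, (h x y).2, (h y x).1,
          (h y x).2, hB y x]
    by_cases hN : neighborsIn G W a = ∅
    · refine ⟨twoColorSum G t W, hsymm, Or.inl fun x y => ?_⟩
      rw [twoColorSumLow_insert t ha, twoColorSumHigh_insert t ha, twoColorSum, hN]
      simp
    · rcases ih (fun u hu v hv w hw => hW u (Finset.mem_insert_of_mem hu) v
        (Finset.mem_insert_of_mem hv) w (Finset.mem_insert_of_mem hw)) with
        rfl | ⟨b, hb, hbmin, B, hB, h⟩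
      · exact absurd rfl hN
      -- An edge from `a` to an element other than `b` would jump over `b`.
      have hNb : neighborsIn G W a = {b} := by
        have hsub : ∀ w ∈ neighborsIn G W a, w = b := by
          intro w hw
          rw [mem_neighborsIn] at hw
          by_contra hne
          exact hW a (Finset.mem_insert_self _ _) b (Finset.mem_insert_of_mem hb) w
            (Finset.mem_insert_of_mem hw.1) (ha b hb)
            (lt_of_le_of_ne (hbmin w hw.1) (Ne.symm hne)) hw.2
        exact Finset.eq_singleton_iff_nonempty_unique_mem.2
          ⟨Finset.nonempty_iff_ne_empty.2 hN, hsub⟩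
      have e1 : ∀ x y, twoColorSumLow G t (insert a W) a x y =
          x * (t * twoColorSumHigh G t W b x y) := by
        intro x y
        rw [twoColorSumLow_insert t ha, hNb, twoColorSumHigh]
        congr 1
        rw [Finset.mul_sum]
        refine Finset.sum_congr rfl fun S _ => ?_
        simp
      have e2 : ∀ x y, twoColorSumHigh G t (insert a W) a x y =
          y * twoColorSumLow G t W b x y := by
        intro x y
        rw [twoColorSumHigh_insert t ha, hNb, twoColorSumLow]
        simp
      -- Prepending `a` to the path of `b` changes its parity and hence interchanges the two
      -- alternatives.
      rcases h with h | h
      · refine ⟨fun x y => x * y * B x y, fun x y => ?_, Or.inr fun x y => ⟨?_, ?_⟩⟩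
        · simp only [hB x y]; ring
        · rw [e1, (h x y).2]; ring
        · rw [e2, (h x y).1]; ring
      · refine ⟨fun x y => t * B x y, fun x y => ?_, Or.inl fun x y => ⟨?_, ?_⟩⟩
        · simp only [hB x y]
        · rw [e1, (h x y).2]
        · rw [e2, (h x y).1]

/-- An edge of `W` that jumps over a vertex of `W` creates a triangle by `hG`, and then there is no
proper two-colouring at all. Otherwise the path structure applies. -/
theorem twoColorSum_comm {G : SimpleGraph α}
    (hG : ∀ u v w, u < v → v < w → G.Adj u w → G.Adj u v ∧ G.Adj v w) (t : R) (W : Finset α)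
    (x y : R) : twoColorSum G t W x y = twoColorSum G t W y x := by
  by_cases hW : ∀ u ∈ W, ∀ v ∈ W, ∀ w ∈ W, u < v → v < w → ¬ G.Adj u w
  · rcases twoColorSum_structure t W hW with rfl | ⟨b, _, _, B, hB, h | h⟩
    · simp [twoColorSum]
    · rw [twoColorSum_eq G t W b, twoColorSum_eq G t W b, (h x y).1, (h x y).2, (h y x).1,
        (h y x).2, hB y x]
      ring
    · rw [twoColorSum_eq G t W b, twoColorSum_eq G t W b, (h x y).1, (h x y).2, (h y x).1,
        (h y x).2, hB y x]
  · push Not at hW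
    obtain ⟨u, hu, v, hv, w, hw, huv, hvw, hadj⟩ := hW
    have hzero : ∀ S, twoColorWeight G t W S = 0 := by
      intro S
      refine if_neg fun h => ?_
      have h1 := h u hu w hw hadj
      have h2 := h u hu v hv (hG u v w huv hvw hadj).1
      have h3 := h v hv w hw (hG u v w huv hvw hadj).2
      unfold indicatorColoring at h1 h2 h3
      split_ifs at h1 h2 h3 <;> omega
    simp [twoColorSum, hzero]

theorem map_twoColorWeight {S : Type*} [CommRing S] (φ : R →+* S) (G : SimpleGraph α) (t : R)
    (W T : Finset α) : φ (twoColorWeight G t W T) = twoColorWeight G (φ t) W T := by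
  unfold twoColorWeight
  split_ifs <;> simp

theorem sum_twoColorWeight_card {G : SimpleGraph α}
    (hG : ∀ u v w, u < v → v < w → G.Adj u w → G.Adj u v ∧ G.Adj v w) (t : R) (W : Finset α)
    (k l : ℕ) (h : k + l = W.card) :
    ∑ S ∈ W.powerset with S.card = k, twoColorWeight G t W S =
      ∑ S ∈ W.powerset with S.card = l, twoColorWeight G t W S := by
  -- With x = 1 and y the polynomial variable, the coefficient of degree `k` selects the sets of
  -- size `k` on one side and those with complement of size `k` on the other.
  have key := congrArg (fun p => Polynomial.coeff p k) (twoColorSum_comm hG (C t) W (1 : R[X]) X)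
  simp only [twoColorSum, one_pow, one_mul, mul_one, finsetSum_coeff, ← map_twoColorWeight,
    coeff_C_mul, coeff_X_pow, mul_ite, mul_zero] at key
  rw [← Finset.sum_filter, ← Finset.sum_filter] at key
  have e1 : (W.powerset.filter fun S => k = S.card) = W.powerset.filter fun S => S.card = k := by
    simp only [eq_comm]
  have e2 : (W.powerset.filter fun S => k = (W \ S).card) =
      W.powerset.filter fun S => S.card = l := by
    refine Finset.filter_congr fun S hS => ?_
    have h1 := Finset.card_sdiff_add_card_eq_card (Finset.mem_powerset.1 hS)
    omega
  rwa [e1, e2] at key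

end TwoColorings

/-! ### Reduction of adjacent transpositions of colours to two-colourings -/

section ChromaticSymmetry

set_option linter.unusedSectionVars false

variable {α : Type*} [LinearOrder α] [Fintype α]

open Classical in
/-- The weight `t ^ asc κ` of a proper colouring `κ`, and `0` for an improper one. -/
noncomputable def chromaticWeight (G : SimpleGraph α) (κ : α → ℕ) : ℚ[X] :=
  if ∀ x ∈ Finset.univ, ∀ y ∈ Finset.univ, G.Adj x y → κ x ≠ κ y then
    X ^ edgeCount G (· < ·) Finset.univ κ else 0

/-- Identify the colours `i` and `i + 1`. -/
def mergeColor (i j : ℕ) : ℕ := if j = i + 1 then i else j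

/-- Recolour the vertices of `S` with the colour `i + 1`. -/
def recolor (i : ℕ) (g : α → ℕ) (S : Finset α) : α → ℕ := fun v => if v ∈ S then i + 1 else g v

theorem mapDomain_mergeColor_self (i : ℕ) (d : ℕ →₀ ℕ) :
    d.mapDomain (mergeColor i) i = d i + d (i + 1) := by
  induction d using Finsupp.induction_linear with
  | zero => simp
  | add f g hf hg => rw [Finsupp.mapDomain_add]; simp only [Finsupp.add_apply, hf, hg]; ring
  | single a b =>
    rw [Finsupp.mapDomain_single]
    simp only [Finsupp.single_apply, mergeColor]
    split_ifs <;> omega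

theorem mapDomain_mergeColor_succ (i : ℕ) (d : ℕ →₀ ℕ) :
    d.mapDomain (mergeColor i) (i + 1) = 0 := by
  induction d using Finsupp.induction_linear with
  | zero => simp
  | add f g hf hg => rw [Finsupp.mapDomain_add]; simp only [Finsupp.add_apply, hf, hg]
  | single a b =>
    rw [Finsupp.mapDomain_single]
    simp only [Finsupp.single_apply, mergeColor]
    split_ifs <;> omega

theorem mapDomain_mergeColor_of_ne {i j : ℕ} (h : j ≠ i) (h' : j ≠ i + 1) (d : ℕ →₀ ℕ) :
    d.mapDomain (mergeColor i) j = d j := by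
  induction d using Finsupp.induction_linear with
  | zero => simp
  | add f g hf hg => rw [Finsupp.mapDomain_add]; simp only [Finsupp.add_apply, hf, hg]
  | single a b =>
    rw [Finsupp.mapDomain_single]
    simp only [Finsupp.single_apply, mergeColor]
    split_ifs <;> omega

/-- Merging retains the sum of the entries at `i` and `i + 1`, so one of them determines the other.
-/
theorem eq_of_mapDomain_mergeColor_eq {i : ℕ} {d e : ℕ →₀ ℕ}
    (h : d.mapDomain (mergeColor i) = e.mapDomain (mergeColor i)) (h' : d (i + 1) = e (i + 1)) :
    d = e := by
  ext j
  by_cases h1 : j = i + 1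
  · rw [h1, h']
  by_cases h2 : j = i
  · have := DFunLike.congr_fun h i
    rw [mapDomain_mergeColor_self, mapDomain_mergeColor_self] at this
    subst h2
    omega
  · have := DFunLike.congr_fun h j
    rwa [mapDomain_mergeColor_of_ne h2 h1, mapDomain_mergeColor_of_ne h2 h1] at this

theorem mapDomain_mergeColor_swap (i : ℕ) (d : ℕ →₀ ℕ) :
    (d.equivMapDomain (Equiv.swap i (i + 1))).mapDomain (mergeColor i) =
      d.mapDomain (mergeColor i) := by
  rw [Finsupp.equivMapDomain_eq_mapDomain, ← Finsupp.mapDomain_comp]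
  congr 1
  funext j
  simp only [Function.comp_apply, mergeColor, Equiv.swap_apply_def]
  split_ifs <;> omega

theorem valueContent_comp (m : ℕ → ℕ) (κ : α → ℕ) :
    valueContent (m ∘ κ) = (valueContent κ).mapDomain m := by
  simp [valueContent, Finsupp.mapDomain_finsetSum, Finsupp.mapDomain_single]

-- The colours `i` and `i + 1` are consecutive and `i + 1` is unused by `g`, so both compare alike
-- with any other colour. Hence recolouring affects only edges inside the class of colour `i`, none
-- of which is an ascent of `g`.
open Classical in
theorem edgeCount_recolor (G : SimpleGraph α) (i : ℕ) {g : α → ℕ} (hg : ∀ v, g v ≠ i + 1)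
    {S : Finset α} (hS : S ⊆ Finset.univ.filter fun v => g v = i) :
    edgeCount G (· < ·) Finset.univ (recolor i g S) = edgeCount G (· < ·) Finset.univ g +
      edgeCount G (· < ·) (Finset.univ.filter fun v => g v = i) (indicatorColoring S) := by
  have hS' : ∀ v ∈ S, g v = i := fun v hv => (Finset.mem_filter.1 (hS hv)).2
  unfold edgeCount
  rw [← Finset.card_union_of_disjoint]
  · congr 1
    ext ⟨u, v⟩
    have hu := hg u
    have hv := hg v
    have hu' := hS' u
    have hv' := hS' v
    simp only [Finset.mem_filter, Finset.mem_union, Finset.mem_product, Finset.mem_univ, true_and]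
    simp only [recolor, indicatorColoring]
    split_ifs with h1 h2 h2
    · simp [hu' h1, hv' h2]
    · have := hu' h1
      constructor
      · rintro ⟨h3, h4, h5⟩
        exact Or.inl ⟨h3, h4, by omega⟩
      · rintro (⟨h3, h4, h5⟩ | ⟨_, _, _, h5⟩)
        · exact ⟨h3, h4, by omega⟩
        · omega
    · have := hv' h2
      constructor
      · rintro ⟨h3, h4, h5⟩
        by_cases h6 : g u = i
        · exact Or.inr ⟨⟨h6, this⟩, h3, h4, by omega⟩
        · exact Or.inl ⟨h3, h4, by omega⟩
      · rintro (⟨h3, h4, h5⟩ | ⟨⟨h6, _⟩, h3, h4, h5⟩)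
        · exact ⟨h3, h4, by omega⟩
        · exact ⟨h3, h4, by omega⟩
    · simp
  · rw [Finset.disjoint_left]
    rintro ⟨u, v⟩ h1 h2
    simp only [Finset.mem_filter, Finset.mem_product, Finset.mem_univ, true_and] at h1 h2
    omega

open Classical in
theorem chromaticWeight_recolor (G : SimpleGraph α) (i : ℕ) {g : α → ℕ} (hg : ∀ v, g v ≠ i + 1)
    {S : Finset α} (hS : S ⊆ Finset.univ.filter fun v => g v = i) :
    chromaticWeight G (recolor i g S) =
      (if ∀ x y, G.Adj x y → ¬ (g x = i ∧ g y = i) → g x ≠ g y then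
        X ^ edgeCount G (· < ·) Finset.univ g else 0) *
      twoColorWeight G X (Finset.univ.filter fun v => g v = i) S := by
  have hS' : ∀ v ∈ S, g v = i := fun v hv => (Finset.mem_filter.1 (hS hv)).2
  have hiff : (∀ x ∈ Finset.univ, ∀ y ∈ Finset.univ, G.Adj x y →
      recolor i g S x ≠ recolor i g S y) ↔
      (∀ x y, G.Adj x y → ¬ (g x = i ∧ g y = i) → g x ≠ g y) ∧
      ∀ u ∈ Finset.univ.filter fun v => g v = i, ∀ v ∈ Finset.univ.filter fun v => g v = i,
        G.Adj u v → indicatorColoring S u ≠ indicatorColoring S v := by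
    simp only [Finset.mem_univ, forall_const, Finset.mem_filter, true_and]
    constructor
    · intro h
      refine ⟨fun x y hxy hne he => ?_, fun u hu v hv huv he => ?_⟩
      · have hx := hS' x
        have hy := hS' y
        have := h x y hxy
        have hx1 : x ∉ S := fun h => hne ⟨hx h, he ▸ hx h⟩
        have hy1 : y ∉ S := fun h => hne ⟨he ▸ hy h, hy h⟩
        simp only [recolor, hx1, hy1, if_false] at this
        exact this he
      · have := h u v huv
        simp only [recolor, indicatorColoring, hu, hv] at this he
        split_ifs at this he <;> omega
    · rintro ⟨h1, h2⟩ x y hxy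
      have hx := hg x
      have hy := hg y
      have hx' := hS' x
      have hy' := hS' y
      by_cases h : g x = i ∧ g y = i
      · have := h2 x h.1 y h.2 hxy
        simp only [recolor, indicatorColoring, h.1, h.2] at this ⊢
        split_ifs at this ⊢ <;> omega
      · have := h1 x y hxy h
        simp only [recolor]
        split_ifs with h3 h4 h4
        · exact absurd ⟨hx' h3, hy' h4⟩ h
        · exact hy.symm
        · exact hx
        · exact this
  unfold chromaticWeight twoColorWeight
  rw [edgeCount_recolor G i hg hS]
  simp only [hiff]
  by_cases h1 : ∀ x y, G.Adj x y → ¬ (g x = i ∧ g y = i) → g x ≠ g y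
  · simp only [eq_true h1, true_and, if_true, mul_ite, mul_zero, pow_add]
  · simp only [eq_false h1, false_and, if_false, zero_mul]

/-- A colouring that merges to `g` is determined by the set of vertices coloured `i + 1`. -/
theorem sum_fiber_mergeColor {R : Type*} [AddCommMonoid R] (i : ℕ) (d : ℕ →₀ ℕ) {g : α → ℕ}
    (hg : valueContent g = d.mapDomain (mergeColor i)) (φ : (α → ℕ) → R) :
    ∑ κ ∈ withContent α d with mergeColor i ∘ κ = g, φ κ =
      ∑ S ∈ (Finset.univ.filter fun v => g v = i).powerset with S.card = d (i + 1),
        φ (recolor i g S) := by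
  have hg' : ∀ v, g v ≠ i + 1 := by
    intro v hv
    have : valueContent g (i + 1) ≠ 0 := valueContent_ne_zero.2 ⟨v, hv⟩
    rw [hg, mapDomain_mergeColor_succ] at this
    exact this rfl
  have hinv : ∀ κ : α → ℕ, mergeColor i ∘ κ = g →
      recolor i g (Finset.univ.filter fun v => κ v = i + 1) = κ := by
    rintro κ rfl
    funext v
    simp only [recolor, Finset.mem_filter, Finset.mem_univ, true_and, Function.comp_apply,
      mergeColor]
    split_ifs with h <;> simp [h]
  refine Finset.sum_bij' (fun κ _ => Finset.univ.filter fun v => κ v = i + 1)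
    (fun S _ => recolor i g S) ?_ ?_ ?_ ?_ ?_
  · intro κ hκ
    rw [Finset.mem_filter, mem_withContent] at hκ
    rw [Finset.mem_filter, Finset.mem_powerset]
    refine ⟨?_, ?_⟩
    · intro v hv
      rw [Finset.mem_filter] at hv ⊢
      refine ⟨hv.1, ?_⟩
      rw [← hκ.2]
      simp [mergeColor, hv.2]
    · rw [← hκ.1, valueContent_apply]
  · intro S hS
    rw [Finset.mem_filter, Finset.mem_powerset] at hS
    have hS' : ∀ v ∈ S, g v = i := fun v hv => (Finset.mem_filter.1 (hS.1 hv)).2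
    have hm : mergeColor i ∘ recolor i g S = g := by
      funext v
      have := hg' v
      have := hS' v
      simp only [Function.comp_apply, mergeColor, recolor]
      split_ifs with h1 <;> first | rfl | omega | (exact (this h1).symm)
    rw [Finset.mem_filter, mem_withContent]
    refine ⟨eq_of_mapDomain_mergeColor_eq (i := i) ?_ ?_, hm⟩
    · rw [← valueContent_comp, hm, hg]
    · rw [← hS.2, valueContent_apply]
      congr 1
      ext v
      have := hg' v
      simp [recolor, this]
  · intro κ hκ
    exact hinv κ (Finset.mem_filter.1 hκ).2
  · intro S hS
    ext v
    have := hg' v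
    simp [recolor, this]
  · intro κ hκ
    rw [hinv κ (Finset.mem_filter.1 hκ).2]

/-- Colourings are grouped by their merged colouring `g`. Within a group the weight is a constant
times a two-colour weight on the class of colour `i`, and the swap exchanges the prescribed sizes of
the two colour classes. -/
theorem sum_chromaticWeight_swap {G : SimpleGraph α}
    (hG : ∀ u v w, u < v → v < w → G.Adj u w → G.Adj u v ∧ G.Adj v w) (i : ℕ) (d : ℕ →₀ ℕ) :
    ∑ κ ∈ withContent α (d.equivMapDomain (Equiv.swap i (i + 1))), chromaticWeight G κ =
      ∑ κ ∈ withContent α d, chromaticWeight G κ := by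
  have hmaps : ∀ e : ℕ →₀ ℕ, ∀ κ ∈ withContent α e,
      mergeColor i ∘ κ ∈ withContent α (e.mapDomain (mergeColor i)) := by
    intro e κ hκ
    rw [mem_withContent] at hκ ⊢
    rw [valueContent_comp, hκ]
  rw [← Finset.sum_fiberwise_of_maps_to (hmaps _), ← Finset.sum_fiberwise_of_maps_to (hmaps d),
    mapDomain_mergeColor_swap]
  refine Finset.sum_congr rfl fun g hg => ?_
  rw [mem_withContent] at hg
  have hg' : ∀ v, g v ≠ i + 1 := by
    intro v hv
    have : valueContent g (i + 1) ≠ 0 := valueContent_ne_zero.2 ⟨v, hv⟩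
    rw [hg, mapDomain_mergeColor_succ] at this
    exact this rfl
  have hsum : ∀ k, ∑ S ∈ (Finset.univ.filter fun v => g v = i).powerset with S.card = k,
      chromaticWeight G (recolor i g S) = _ :=
    fun k => (Finset.sum_congr rfl fun S hS => chromaticWeight_recolor G i hg'
      (Finset.mem_powerset.1 (Finset.mem_filter.1 hS).1)).trans (Finset.mul_sum _ _ _).symm
  rw [sum_fiber_mergeColor i d hg, sum_fiber_mergeColor i _
    (hg.trans (mapDomain_mergeColor_swap i d).symm), hsum, hsum]
  congr 1
  refine sum_twoColorWeight_card hG X _ _ _ ?_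
  rw [← valueContent_apply, hg, mapDomain_mergeColor_self, Finsupp.equivMapDomain_apply,
    Equiv.symm_swap, Equiv.swap_apply_right]

end ChromaticSymmetry

/-! ### Coefficients of the chromatic quasisymmetric function -/

section ChromaticCoefficients

variable {V : Finset ℕ}

theorem edgeCount_univ_eq_ncard (G : SimpleGraph V) (r : ℕ → ℕ → Prop) (f : V → ℕ) :
    edgeCount G r Finset.univ f =
      {e : V × V | G.Adj e.1 e.2 ∧ (e.1 : ℕ) < (e.2 : ℕ) ∧ r (f e.1) (f e.2)}.ncard := by
  classical
  rw [edgeCount, ← Set.ncard_coe_finset]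
  congr 1
  ext e
  simp

theorem coeff_chromaticQSym (G : SimpleGraph V) (d : ℕ →₀ ℕ) :
    MvPowerSeries.coeff d (chromaticQSym G) = ∑ κ ∈ withContent V d, chromaticWeight G κ := by
  classical
  change ∑ κ : {κ : G.Coloring ℕ // colorContent κ = d}, (X : ℚ[X]) ^ ascents κ.1 = _
  have hw : ∀ κ : V → ℕ, chromaticWeight G κ =
      if ∀ x y, G.Adj x y → κ x ≠ κ y then X ^ edgeCount G (· < ·) Finset.univ κ else 0 := by
    intro κ
    simp only [chromaticWeight, Finset.mem_univ, forall_const]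
  simp only [hw]
  rw [← Finset.sum_filter]
  refine Finset.sum_bij (fun κ _ => κ.1) ?_ ?_ ?_ ?_
  · intro κ _
    rw [Finset.mem_filter, mem_withContent]
    exact ⟨κ.2, fun x y h => κ.1.valid h⟩
  · intro κ _ κ' _ h
    exact Subtype.ext (RelHom.ext fun v => congrFun h v)
  · intro κ hκ
    rw [Finset.mem_filter, mem_withContent] at hκ
    exact ⟨⟨SimpleGraph.Coloring.mk κ fun {x y} h => hκ.2 x y h, hκ.1⟩,
      Finset.mem_univ _, rfl⟩
  · intro κ _
    rw [edgeCount_univ_eq_ncard]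
    rfl

theorem isSwapInvariant_chromaticQSym {G : SimpleGraph V}
    (hG : ∀ u v w : V, u < v → v < w → G.Adj u w → G.Adj u v ∧ G.Adj v w) :
    IsSwapInvariant (chromaticQSym G) := by
  intro i d
  rw [coeff_chromaticQSym, coeff_chromaticQSym]
  exact sum_chromaticWeight_swap hG i d

end ChromaticCoefficients

/-! ### Symmetry of Schur functions: the Bender–Knuth involution -/

section BenderKnuth

variable {μ : YoungDiagram}

/-- The number of entries smaller than `k` in row `r`. -/
def rowCount (T : SemistandardYoungTableau μ) (k r : ℕ) : ℕ :=
  ((Finset.range (μ.rowLen r)).filter fun c => T r c < k).card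

theorem lt_card_iff_mem_of_isLowerSet {s : Finset ℕ} (h : ∀ a ∈ s, ∀ b ≤ a, b ∈ s) {c : ℕ} :
    c < s.card ↔ c ∈ s := by
  constructor
  · intro hc
    by_contra hcs
    have : s ⊆ Finset.range c := by
      intro a ha
      rw [Finset.mem_range]
      by_contra hac
      exact hcs (h a ha c (by omega))
    have := Finset.card_le_card this
    rw [Finset.card_range] at this
    omega
  · intro hc
    have : Finset.range (c + 1) ⊆ s := fun b hb => h c hc b (by rw [Finset.mem_range] at hb; omega)
    have := Finset.card_le_card this
    rwa [Finset.card_range] at this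

theorem lt_rowCount_iff (T : SemistandardYoungTableau μ) {k r c : ℕ} :
    c < rowCount T k r ↔ c < μ.rowLen r ∧ T r c < k := by
  rw [rowCount, lt_card_iff_mem_of_isLowerSet, Finset.mem_filter, Finset.mem_range]
  intro a ha b hb
  rw [Finset.mem_filter, Finset.mem_range] at ha ⊢
  have := T.row_weak_of_le hb (YoungDiagram.mem_iff_lt_rowLen.2 ha.1)
  omega

theorem rowCount_eq {T : SemistandardYoungTableau μ} {k r m : ℕ}
    (h : ∀ c, c < m ↔ c < μ.rowLen r ∧ T r c < k) : rowCount T k r = m := by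
  apply le_antisymm
  · by_contra hlt
    have h1 := (h m).2 (lt_rowCount_iff T |>.1 (by omega))
    omega
  · by_contra hlt
    have h1 := lt_rowCount_iff T |>.2 ((h (rowCount T k r)).1 (by omega))
    omega

theorem rowCount_le_rowLen (T : SemistandardYoungTableau μ) (k r : ℕ) :
    rowCount T k r ≤ μ.rowLen r :=
  (Finset.card_filter_le _ _).trans (Finset.card_range _).le

theorem rowCount_mono (T : SemistandardYoungTableau μ) {k l : ℕ} (h : k ≤ l) (r : ℕ) :
    rowCount T k r ≤ rowCount T l r :=
  Finset.card_le_card fun c hc => by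
    rw [Finset.mem_filter] at hc ⊢
    exact ⟨hc.1, hc.2.trans_le h⟩

/-- This is column strictness. Together with `rowCount_mono` it says that the sequences `rowCount T
k` form a Gelfand–Tsetlin pattern, and the involution will alter only the level `i + 1` of this
pattern. -/
theorem rowCount_succ_succ_le (T : SemistandardYoungTableau μ) (k r : ℕ) :
    rowCount T (k + 1) (r + 1) ≤ rowCount T k r := by
  by_contra hlt
  obtain ⟨h1, h2⟩ := (lt_rowCount_iff T (k := k + 1) (r := r + 1) (c := rowCount T k r)).1 (by omega)
  have h3 := T.col_strict (Nat.lt_add_one r) (YoungDiagram.mem_iff_lt_rowLen.2 h1)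
  have h4 := (lt_rowCount_iff T (c := rowCount T k r)).2
    ⟨h1.trans_le (μ.rowLen_anti r (r + 1) (by omega)), show T r _ < k by omega⟩
  omega

/-- The largest possible number of entries at most `i` in row `r`, the other entries being fixed. -/
def upperBound (T : SemistandardYoungTableau μ) (i r : ℕ) : ℕ :=
  if r = 0 then rowCount T (i + 2) 0 else min (rowCount T (i + 2) r) (rowCount T i (r - 1))

/-- The least possible number of entries at most `i` in row `r`, the other entries being fixed. -/
def lowerBound (T : SemistandardYoungTableau μ) (i r : ℕ) : ℕ :=
  max (rowCount T (i + 2) (r + 1)) (rowCount T i r)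

/-- The number of entries at most `i` in row `r` after the Bender–Knuth involution. -/
def toggledCount (T : SemistandardYoungTableau μ) (i r : ℕ) : ℕ :=
  upperBound T i r + lowerBound T i r - rowCount T (i + 1) r

theorem bounds (T : SemistandardYoungTableau μ) (i r : ℕ) :
    lowerBound T i r ≤ rowCount T (i + 1) r ∧ rowCount T (i + 1) r ≤ upperBound T i r := by
  have h1 := rowCount_mono T (Nat.le_succ i) r
  have h2 := rowCount_mono T (Nat.le_succ (i + 1)) r
  have h3 := rowCount_succ_succ_le T (i + 1) r
  refine ⟨max_le h3 h1, ?_⟩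
  unfold upperBound
  split_ifs with h
  · subst h; exact h2
  · have h4 := rowCount_succ_succ_le T i (r - 1)
    rw [Nat.sub_add_cancel (by omega)] at h4
    exact le_min h2 h4

/-- The toggle reflects a count within the interval allowed by the levels `i` and `i + 2`. By
`bounds` the natural subtraction does not truncate, and the result stays in the interval, so the
pattern still interlaces. -/
theorem toggledCount_bounds (T : SemistandardYoungTableau μ) (i r : ℕ) :
    rowCount T i r ≤ toggledCount T i r ∧ toggledCount T i r ≤ rowCount T (i + 2) r ∧
      rowCount T (i + 2) (r + 1) ≤ toggledCount T i r ∧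
      toggledCount T i (r + 1) ≤ rowCount T i r := by
  obtain ⟨h1, h2⟩ := bounds T i r
  obtain ⟨h3, h4⟩ := bounds T i (r + 1)
  have h5 : rowCount T i r ≤ lowerBound T i r := le_max_right _ _
  have h6 : rowCount T (i + 2) (r + 1) ≤ lowerBound T i r := le_max_left _ _
  have h7 : upperBound T i r ≤ rowCount T (i + 2) r := by
    unfold upperBound
    split_ifs with h
    · subst h; exact le_rfl
    · exact min_le_left _ _
  have h8 : upperBound T i (r + 1) ≤ rowCount T i r := by
    unfold upperBound
    rw [if_neg (by omega)]
    exact min_le_right _ _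
  unfold toggledCount
  omega

/-- The entries of a tableau after the Bender–Knuth involution. -/
def toggledEntry (T : SemistandardYoungTableau μ) (i r c : ℕ) : ℕ :=
  if c < μ.rowLen r then
    -- Entries below `i` and entries from `i + 2` on are kept; only the stretch filled with `i` and
    -- `i + 1` is rewritten.
    if c < rowCount T i r ∨ rowCount T (i + 2) r ≤ c then T r c
    else if c < toggledCount T i r then i else i + 1
  else 0

theorem toggledEntry_lt_succ (T : SemistandardYoungTableau μ) (i : ℕ) {r c : ℕ}
    (h : (r + 1, c) ∈ μ) : toggledEntry T i r c < toggledEntry T i (r + 1) c := by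
  have hc := YoungDiagram.mem_iff_lt_rowLen.1 h
  have hc' := hc.trans_le (μ.rowLen_anti r (r + 1) (by omega))
  have h1 := T.col_strict (Nat.lt_add_one r) h
  have h2 := toggledCount_bounds T i r
  have h3 := toggledCount_bounds T i (r + 1)
  have h4 := lt_rowCount_iff T (k := i) (r := r) (c := c)
  have h5 := lt_rowCount_iff T (k := i + 2) (r := r) (c := c)
  have h6 := lt_rowCount_iff T (k := i) (r := r + 1) (c := c)
  have h7 := lt_rowCount_iff T (k := i + 2) (r := r + 1) (c := c)
  simp only [hc, hc', true_and] at h4 h5 h6 h7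
  unfold toggledEntry
  rw [if_pos hc, if_pos hc']
  split_ifs <;> omega

/-- The Bender–Knuth involution exchanging the multiplicities of `i` and `i + 1`. -/
def benderKnuth (i : ℕ) (T : SemistandardYoungTableau μ) : SemistandardYoungTableau μ where
  entry := toggledEntry T i
  row_weak' := by
    intro r c₁ c₂ h hc
    have h1 := T.row_weak h hc
    rw [YoungDiagram.mem_iff_lt_rowLen] at hc
    have hc' : c₁ < μ.rowLen r := h.trans hc
    have h2 := toggledCount_bounds T i r
    have h4 := lt_rowCount_iff T (k := i) (r := r) (c := c₁)
    have h5 := lt_rowCount_iff T (k := i + 2) (r := r) (c := c₁)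
    have h6 := lt_rowCount_iff T (k := i) (r := r) (c := c₂)
    have h7 := lt_rowCount_iff T (k := i + 2) (r := r) (c := c₂)
    simp only [hc, hc', true_and] at h4 h5 h6 h7
    unfold toggledEntry
    rw [if_pos hc, if_pos hc']
    split_ifs <;> omega
  col_strict' := by
    intro r₁ r₂ c h hc
    induction r₂, h using Nat.le_induction with
    | base => exact toggledEntry_lt_succ T i hc
    | succ r₂ h ih =>
      exact (ih (μ.up_left_mem (Nat.le_succ r₂) le_rfl hc)).trans (toggledEntry_lt_succ T i hc)
  zeros' := by
    intro r c h
    rw [YoungDiagram.mem_iff_lt_rowLen] at h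
    exact if_neg h

theorem benderKnuth_apply (i : ℕ) (T : SemistandardYoungTableau μ) (r c : ℕ) :
    benderKnuth i T r c = toggledEntry T i r c := rfl

theorem rowCount_benderKnuth_of_ne {i k : ℕ} (hk : k ≠ i + 1) (T : SemistandardYoungTableau μ)
    (r : ℕ) : rowCount (benderKnuth i T) k r = rowCount T k r := by
  refine rowCount_eq fun c => ?_
  rw [lt_rowCount_iff]
  refine and_congr_right fun hc => ?_
  have h4 := lt_rowCount_iff T (k := i) (r := r) (c := c)
  have h5 := lt_rowCount_iff T (k := i + 2) (r := r) (c := c)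
  simp only [hc, true_and] at h4 h5
  rw [benderKnuth_apply, toggledEntry, if_pos hc]
  split_ifs <;> omega

theorem rowCount_benderKnuth (i : ℕ) (T : SemistandardYoungTableau μ) (r : ℕ) :
    rowCount (benderKnuth i T) (i + 1) r = toggledCount T i r := by
  refine rowCount_eq fun c => ?_
  have h2 := toggledCount_bounds T i r
  have h3 := rowCount_le_rowLen T (i + 2) r
  by_cases hc : c < μ.rowLen r
  · have h4 := lt_rowCount_iff T (k := i) (r := r) (c := c)
    have h5 := lt_rowCount_iff T (k := i + 2) (r := r) (c := c)
    simp only [hc, true_and] at h4 h5 ⊢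
    rw [benderKnuth_apply, toggledEntry, if_pos hc]
    split_ifs <;> omega
  · simp only [hc, false_and, iff_false]
    omega

/-- The interval depends only on the unchanged levels `i` and `i + 2`, so the second reflection
undoes the first. -/
theorem benderKnuth_involutive (i : ℕ) :
    Function.Involutive (benderKnuth i : SemistandardYoungTableau μ → _) := by
  intro T
  have h1 : ∀ r, upperBound (benderKnuth i T) i r = upperBound T i r := fun r => by
    simp only [upperBound, rowCount_benderKnuth_of_ne (i := i) (k := i + 2) (by omega),
      rowCount_benderKnuth_of_ne (i := i) (k := i) (by omega)]
  have h2 : ∀ r, lowerBound (benderKnuth i T) i r = lowerBound T i r := fun r => by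
    simp only [lowerBound, rowCount_benderKnuth_of_ne (i := i) (k := i + 2) (by omega),
      rowCount_benderKnuth_of_ne (i := i) (k := i) (by omega)]
  have h3 : ∀ r, toggledCount (benderKnuth i T) i r = rowCount T (i + 1) r := fun r => by
    have := bounds T i r
    rw [toggledCount, h1, h2, rowCount_benderKnuth, toggledCount]
    omega
  ext r c
  rw [benderKnuth_apply, toggledEntry, h3,
    rowCount_benderKnuth_of_ne (i := i) (k := i + 2) (by omega),
    rowCount_benderKnuth_of_ne (i := i) (k := i) (by omega), benderKnuth_apply, toggledEntry]
  by_cases hc : c < μ.rowLen r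
  · have h4 := lt_rowCount_iff T (k := i) (r := r) (c := c)
    have h5 := lt_rowCount_iff T (k := i + 2) (r := r) (c := c)
    have h6 := lt_rowCount_iff T (k := i + 1) (r := r) (c := c)
    simp only [hc, true_and] at h4 h5 h6
    rw [if_pos hc, if_pos hc]
    split_ifs <;> omega
  · rw [if_neg hc, T.zeros fun h => hc (YoungDiagram.mem_iff_lt_rowLen.1 h)]

/-- The lower bound in row r and the upper bound in row r + 1 are the maximum and the minimum of the
same two counts, so they have the same sum as these counts. The boundary terms are the row 0, whose
upper bound is a single count, and the first empty row, where everything is zero. -/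
theorem sum_bounds (T : SemistandardYoungTableau μ) (i : ℕ) :
    ∑ r ∈ Finset.range (μ.colLen 0), (upperBound T i r + lowerBound T i r) =
      ∑ r ∈ Finset.range (μ.colLen 0), rowCount T (i + 2) r +
        ∑ r ∈ Finset.range (μ.colLen 0), rowCount T i r := by
  have key : ∀ R, ∑ r ∈ Finset.range (R + 1), upperBound T i r +
      ∑ r ∈ Finset.range R, lowerBound T i r = ∑ r ∈ Finset.range (R + 1), rowCount T (i + 2) r +
        ∑ r ∈ Finset.range R, rowCount T i r := by
    intro R
    induction R with
    | zero => simp [upperBound]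
    | succ R ih =>
      rw [Finset.sum_range_succ, Finset.sum_range_succ (fun r => lowerBound T i r),
        Finset.sum_range_succ (fun r => rowCount T (i + 2) r) (R + 1),
        Finset.sum_range_succ (fun r => rowCount T i r)]
      have : upperBound T i (R + 1) + lowerBound T i R =
          rowCount T (i + 2) (R + 1) + rowCount T i R := by
        rw [upperBound, if_neg (by omega), lowerBound, Nat.add_sub_cancel]
        exact min_add_max _ _
      omega
  have h0 : rowCount T (i + 2) (μ.colLen 0) = 0 := by
    by_contra h
    have h1 := (lt_rowCount_iff T (c := 0)).1 (Nat.pos_of_ne_zero h)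
    have h2 := YoungDiagram.mem_iff_lt_colLen.1 (YoungDiagram.mem_iff_lt_rowLen.2 h1.1)
    omega
  have h1 : upperBound T i (μ.colLen 0) = 0 := by
    unfold upperBound
    split_ifs with h
    · rw [h] at h0; exact h0
    · rw [h0, Nat.zero_min]
  have := key (μ.colLen 0)
  rw [Finset.sum_range_succ, h1, Finset.sum_range_succ (fun r => rowCount T (i + 2) r), h0] at this
  rw [Finset.sum_add_distrib]
  exact this

theorem tableauContent_apply (T : SemistandardYoungTableau μ) (k : ℕ) :
    tableauContent T k = (μ.cells.filter fun c => T c.1 c.2 = k).card := by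
  simp [tableauContent, Finsupp.finsetSum_apply, Finsupp.single_apply]

theorem sum_rowCount (T : SemistandardYoungTableau μ) (k : ℕ) :
    ∑ r ∈ Finset.range (μ.colLen 0), rowCount T k r =
      (μ.cells.filter fun c => T c.1 c.2 < k).card := by
  rw [Finset.card_eq_sum_card_fiberwise (f := Prod.fst) (t := Finset.range (μ.colLen 0))]
  · refine Finset.sum_congr rfl fun r _ => ?_
    rw [rowCount, ← Finset.card_map ⟨fun c => (r, c), Prod.mk_right_injective r⟩]
    congr 1
    ext ⟨a, b⟩
    simp only [Finset.mem_map, Finset.mem_filter, Finset.mem_range, Function.Embedding.coeFn_mk,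
      Prod.mk.injEq, YoungDiagram.mem_cells, ← YoungDiagram.mem_iff_lt_rowLen]
    constructor
    · rintro ⟨c, ⟨h1, h2⟩, rfl, rfl⟩
      exact ⟨⟨h1, h2⟩, rfl⟩
    · rintro ⟨⟨h1, h2⟩, rfl⟩
      exact ⟨b, ⟨h1, h2⟩, rfl, rfl⟩
  · rintro ⟨a, b⟩ h
    simp only [Finset.coe_filter, Set.mem_ofPred_eq, YoungDiagram.mem_cells] at h
    simp only [Finset.coe_range, Set.mem_Iio]
    exact YoungDiagram.mem_iff_lt_colLen.1 (μ.up_left_mem le_rfl (Nat.zero_le b) h.1)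

theorem sum_rowCount_succ (T : SemistandardYoungTableau μ) (k : ℕ) :
    ∑ r ∈ Finset.range (μ.colLen 0), rowCount T (k + 1) r =
      ∑ r ∈ Finset.range (μ.colLen 0), rowCount T k r + tableauContent T k := by
  rw [sum_rowCount, sum_rowCount, tableauContent_apply, ← Finset.card_union_of_disjoint]
  · congr 1
    ext c
    simp only [Finset.mem_filter, Finset.mem_union, ← and_or_left]
    refine and_congr_right fun _ => ?_
    omega
  · rw [Finset.disjoint_left]
    intro c h h'
    rw [Finset.mem_filter] at h h'
    omega

/-- Multiplicities are differences of the row totals at consecutive levels. By `sum_bounds` the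
total at level `i + 1` is reflected about the midpoint of its neighbouring totals, which exchanges
the two differences. -/
theorem tableauContent_benderKnuth (i : ℕ) (T : SemistandardYoungTableau μ) :
    tableauContent (benderKnuth i T) =
      (tableauContent T).equivMapDomain (Equiv.swap i (i + 1)) := by
  have hsum : ∑ r ∈ Finset.range (μ.colLen 0), toggledCount T i r +
      ∑ r ∈ Finset.range (μ.colLen 0), rowCount T (i + 1) r =
      ∑ r ∈ Finset.range (μ.colLen 0), (upperBound T i r + lowerBound T i r) := by
    rw [← Finset.sum_add_distrib]
    refine Finset.sum_congr rfl fun r _ => ?_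
    have := bounds T i r
    unfold toggledCount
    omega
  rw [sum_bounds] at hsum
  have h1 := sum_rowCount_succ T i
  have h2 := sum_rowCount_succ T (i + 1)
  have e2 : i + 1 + 1 = i + 2 := rfl
  rw [e2] at h2
  ext k
  rw [Finsupp.equivMapDomain_apply, Equiv.symm_swap, Equiv.swap_apply_def]
  have hk := sum_rowCount_succ (benderKnuth i T) k
  have hk' := sum_rowCount_succ T k
  split_ifs with h h'
  · subst h
    simp only [rowCount_benderKnuth, rowCount_benderKnuth_of_ne (i := k) (k := k) (by omega)] at hk
    omega
  · subst h'
    simp only [rowCount_benderKnuth,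
      rowCount_benderKnuth_of_ne (i := i) (k := i + 2) (by omega), e2] at hk
    omega
  · simp only [rowCount_benderKnuth_of_ne (i := i) (k := k) h',
      rowCount_benderKnuth_of_ne (i := i) (k := k + 1) (by omega)] at hk
    omega

theorem isSwapInvariant_schurFunction (R : Type*) [CommSemiring R] (μ : YoungDiagram) :
    IsSwapInvariant (schurFunction R μ) := by
  intro i d
  change (Nat.card {T : SemistandardYoungTableau μ // tableauContent T = _} : R) =
    (Nat.card {T : SemistandardYoungTableau μ // tableauContent T = d} : R)
  congr 1
  refine Nat.card_congr ((benderKnuth_involutive i).toPerm.subtypeEquiv fun T => ?_)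
  rw [Function.Involutive.coe_toPerm, tableauContent_benderKnuth]
  have hinv : ∀ e : ℕ →₀ ℕ, (e.equivMapDomain (Equiv.swap i (i + 1))).equivMapDomain
      (Equiv.swap i (i + 1)) = e := by
    intro e
    ext k
    simp [Finsupp.equivMapDomain_apply]
  constructor
  · rintro h
    rw [h, hinv]
  · rintro rfl
    rw [hinv]

end BenderKnuth

/-! ### Schur expansions of symmetric functions -/

section SchurExpansion

/-- The exponent vector whose entries are the row lengths of `μ`. -/
noncomputable def rowExponent (μ : YoungDiagram) : ℕ →₀ ℕ := ∑ c ∈ μ.cells, Finsupp.single c.1 1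

theorem rowExponent_apply (μ : YoungDiagram) (r : ℕ) : rowExponent μ r = μ.rowLen r := by
  rw [YoungDiagram.rowLen_eq_card, YoungDiagram.row]
  simp [rowExponent, Finsupp.finsetSum_apply, Finsupp.single_apply]

theorem rowExponent_injective : Function.Injective rowExponent := by
  intro μ ν h
  ext ⟨i, j⟩
  rw [YoungDiagram.mem_cells, YoungDiagram.mem_cells, YoungDiagram.mem_iff_lt_rowLen,
    YoungDiagram.mem_iff_lt_rowLen, ← rowExponent_apply, ← rowExponent_apply, h]

theorem degree_rowExponent (μ : YoungDiagram) : (rowExponent μ).degree = μ.card := by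
  simp [rowExponent, YoungDiagram.card]

theorem exists_rowExponent_eq {d : ℕ →₀ ℕ} (hd : ∀ i, d (i + 1) ≤ d i) :
    ∃ μ, rowExponent μ = d := by
  have hanti : Antitone d := antitone_nat_of_succ_le hd
  let μ : YoungDiagram :=
    -- The box only keeps the set of cells finite; monotonicity of `d` makes the condition `c.2 < d
    -- c.1` imply membership in it.
    { cells := (d.support ×ˢ Finset.range (d 0)).filter fun c => c.2 < d c.1
      isLowerSet := by
        rintro ⟨a, b⟩ ⟨a', b'⟩ ⟨h1, h2⟩ h
        simp only [Finset.coe_filter, Finset.mem_product, Finsupp.mem_support_iff,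
          Finset.mem_range, Set.mem_ofPred_eq] at h h1 h2 ⊢
        have h3 := hanti h1
        have h4 := hanti (Nat.zero_le a')
        omega }
  refine ⟨μ, ?_⟩
  have hmem : ∀ i j, (i, j) ∈ μ ↔ j < d i := by
    intro i j
    rw [← YoungDiagram.mem_cells]
    simp only [μ, Finset.mem_filter, Finset.mem_product, Finsupp.mem_support_iff, Finset.mem_range]
    have := hanti (Nat.zero_le i)
    omega
  ext i
  rw [rowExponent_apply]
  have h1 := hmem i (μ.rowLen i)
  have h2 := hmem i (d i)
  rw [YoungDiagram.mem_iff_lt_rowLen] at h1 h2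
  omega

/-- The weight `∑ i, i * d i` of an exponent vector. -/
noncomputable def exponentWeight : (ℕ →₀ ℕ) →+ ℕ := Finsupp.weight (fun i : ℕ => i)

theorem exponentWeight_single (i a : ℕ) : exponentWeight (Finsupp.single i a) = a * i := by
  simp [exponentWeight, Finsupp.weight_single]

theorem exponentWeight_tableauContent {μ : YoungDiagram} (T : SemistandardYoungTableau μ) :
    exponentWeight (tableauContent T) = ∑ c ∈ μ.cells, T c.1 c.2 := by
  simp [tableauContent, exponentWeight_single]

theorem exponentWeight_rowExponent (μ : YoungDiagram) :
    exponentWeight (rowExponent μ) = ∑ c ∈ μ.cells, c.1 := by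
  simp [rowExponent, exponentWeight_single]

theorem row_le_entry {μ : YoungDiagram} (T : SemistandardYoungTableau μ) {i j : ℕ}
    (h : (i, j) ∈ μ) : i ≤ T i j := by
  induction i with
  | zero => exact Nat.zero_le _
  | succ i ih =>
    have := ih (μ.up_left_mem (Nat.le_add_right i 1) le_rfl h)
    have := T.col_strict (Nat.lt_add_one i) h
    omega

theorem exponentWeight_rowExponent_le {μ : YoungDiagram} (T : SemistandardYoungTableau μ) :
    exponentWeight (rowExponent μ) ≤ exponentWeight (tableauContent T) := by
  rw [exponentWeight_rowExponent, exponentWeight_tableauContent]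
  exact Finset.sum_le_sum fun c hc => row_le_entry T hc

/-- Every entry is at least its row index, so equality of the sums forces equality in every cell. -/
theorem eq_highestWeight {μ : YoungDiagram} {T : SemistandardYoungTableau μ}
    (h : exponentWeight (tableauContent T) = exponentWeight (rowExponent μ)) :
    T = SemistandardYoungTableau.highestWeight μ := by
  rw [exponentWeight_rowExponent, exponentWeight_tableauContent] at h
  have key := (Finset.sum_eq_sum_iff_of_le fun c (hc : c ∈ μ.cells) => row_le_entry T hc).1 h.symm
  ext i j
  rw [SemistandardYoungTableau.highestWeight_apply]
  split_ifs with hij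
  · exact (key (i, j) hij).symm
  · exact T.zeros hij

theorem tableauContent_highestWeight (μ : YoungDiagram) :
    tableauContent (SemistandardYoungTableau.highestWeight μ) = rowExponent μ := by
  refine Finset.sum_congr rfl fun c hc => ?_
  rw [SemistandardYoungTableau.highestWeight_apply, if_pos (by exact hc)]

variable {R : Type*} [CommRing R]

theorem coeff_rowExponent_self (μ : YoungDiagram) :
    MvPowerSeries.coeff (rowExponent μ) (schurFunction R μ) = 1 := by
  change (Nat.card {T : SemistandardYoungTableau μ // tableauContent T = rowExponent μ} : R) = 1
  have : Nat.card {T : SemistandardYoungTableau μ // tableauContent T = rowExponent μ} = 1 := by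
    rw [Nat.card_eq_one_iff_unique]
    refine ⟨⟨fun T T' => Subtype.ext ?_⟩, ⟨⟨_, tableauContent_highestWeight μ⟩⟩⟩
    rw [eq_highestWeight (congrArg exponentWeight T.2),
      eq_highestWeight (congrArg exponentWeight T'.2)]
  rw [this, Nat.cast_one]

/-- Unitriangularity of the Kostka numbers, ordered by the numerical weight in place of dominance:
the highest-weight tableau is the only one of least weight. -/
theorem coeff_schurFunction_of_weight_le {μ : YoungDiagram} {d : ℕ →₀ ℕ}
    (h : exponentWeight d ≤ exponentWeight (rowExponent μ)) (hne : d ≠ rowExponent μ) :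
    MvPowerSeries.coeff d (schurFunction R μ) = 0 := by
  change (Nat.card {T : SemistandardYoungTableau μ // tableauContent T = d} : R) = 0
  have : IsEmpty {T : SemistandardYoungTableau μ // tableauContent T = d} := by
    refine ⟨fun T => hne ?_⟩
    have h1 := exponentWeight_rowExponent_le T.1
    have h2 := T.2
    rw [← h2] at h
    rw [← h2, eq_highestWeight (le_antisymm h h1), tableauContent_highestWeight]
  simp

theorem exponentWeight_swap_lt {i : ℕ} {d : ℕ →₀ ℕ} (h : d i < d (i + 1)) :
    exponentWeight (d.equivMapDomain (Equiv.swap i (i + 1))) < exponentWeight d := by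
  obtain ⟨k, hk⟩ := Nat.exists_eq_add_of_lt h
  -- Here `k + 1` is the excess of `d (i + 1)` over `d i`. Adding multiples of unit vectors on both
  -- sides avoids subtraction of exponents.
  have key : d.equivMapDomain (Equiv.swap i (i + 1)) + Finsupp.single (i + 1) (k + 1) =
      d + Finsupp.single i (k + 1) := by
    ext j
    simp only [Finsupp.add_apply, Finsupp.equivMapDomain_apply, Equiv.symm_swap,
      Equiv.swap_apply_def, Finsupp.single_apply]
    split_ifs <;> first | omega | (subst_vars; omega)
  have := congrArg exponentWeight key
  rw [map_add, map_add, exponentWeight_single, exponentWeight_single] at this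
  nlinarith

/-- A symmetric function vanishes if its coefficients at all partitions do. -/
theorem coeff_eq_zero_of_isSwapInvariant {f : MvPowerSeries ℕ R} (hf : IsSwapInvariant f)
    (h : ∀ μ, MvPowerSeries.coeff (rowExponent μ) f = 0) : f = 0 := by
  -- Induction on the weight: where an exponent increases, the swap lowers its weight and keeps the
  -- coefficient; an exponent without increases comes from a partition.
  have key : ∀ m, ∀ d : ℕ →₀ ℕ, exponentWeight d = m → MvPowerSeries.coeff d f = 0 := by
    intro m
    induction m using Nat.strong_induction_on with
    | _ m ih =>
      intro d hd
      by_cases hanti : ∀ i, d (i + 1) ≤ d i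
      · obtain ⟨μ, rfl⟩ := exists_rowExponent_eq hanti
        exact h μ
      · push Not at hanti
        obtain ⟨i, hi⟩ := hanti
        rw [← hf i d]
        exact ih _ (hd ▸ exponentWeight_swap_lt hi) _ rfl
  ext d
  rw [key _ d rfl]
  simp

theorem finite_setOf_card_eq (n : ℕ) : {μ : YoungDiagram | μ.card = n}.Finite := by
  refine Set.Finite.of_finite_image (f := YoungDiagram.cells) ?_ fun μ _ ν _ h => ?_
  · refine ((Finset.range n ×ˢ Finset.range n).powerset : Finset (Finset (ℕ × ℕ))).finite_toSet.subset ?_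
    rintro _ ⟨μ, hμ, rfl⟩
    rw [Finset.mem_coe, Finset.mem_powerset]
    rintro ⟨i, j⟩ hij
    have h1 := YoungDiagram.mem_iff_lt_rowLen.1 hij
    have h2 := YoungDiagram.mem_iff_lt_colLen.1 hij
    rw [YoungDiagram.rowLen_eq_card] at h1
    rw [YoungDiagram.colLen_eq_card] at h2
    have h3 : (μ.row i).card ≤ n := hμ ▸ Finset.card_le_card (Finset.filter_subset _ _)
    have h4 : (μ.col j).card ≤ n := hμ ▸ Finset.card_le_card (Finset.filter_subset _ _)
    rw [Finset.mem_product, Finset.mem_range, Finset.mem_range]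
    exact ⟨h2.trans_le h4, h1.trans_le h3⟩
  · exact YoungDiagram.ext h

/-- Homogeneous symmetric functions are finite linear combinations of Schur functions. -/
theorem exists_isSchurExpansion {f : MvPowerSeries ℕ R} (hf : IsSwapInvariant f) {n : ℕ}
    (hdeg : ∀ d : ℕ →₀ ℕ, d.degree ≠ n → MvPowerSeries.coeff d f = 0) :
    ∃ c : YoungDiagram →₀ R, IsSchurExpansion f c := by
  classical
  let Y : Finset YoungDiagram := (finite_setOf_card_eq n).toFinset
  have hY : ∀ μ, μ ∈ Y ↔ μ.card = n := fun μ => by simp [Y]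
  let wt : YoungDiagram → ℕ := fun μ => exponentWeight (rowExponent μ)
  let B := Y.sup wt + 1
  have hB : ∀ μ ∈ Y, wt μ < B := fun μ hμ => Nat.lt_succ_of_le (Finset.le_sup hμ)
  -- Partitions are eliminated in order of increasing weight, with `m` bounding the number of weight
  -- levels still to be treated. Subtracting the Schur functions of the current level does not
  -- disturb the coefficients at partitions of lower weight. For `m = B` the vanishing hypothesis is
  -- vacuous.
  have key : ∀ m, ∀ f : MvPowerSeries ℕ R, IsSwapInvariant f →
      (∀ d : ℕ →₀ ℕ, d.degree ≠ n → MvPowerSeries.coeff d f = 0) →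
      (∀ μ ∈ Y, wt μ + m < B → MvPowerSeries.coeff (rowExponent μ) f = 0) →
      f ∈ Submodule.span R (Set.range (schurFunction R)) := by
    intro m
    induction m with
    | zero =>
      intro f hf hdeg h
      rw [coeff_eq_zero_of_isSwapInvariant hf fun μ => ?_]
      · exact Submodule.zero_mem _
      · by_cases hμ : μ ∈ Y
        · exact h μ hμ (hB μ hμ)
        · refine hdeg _ ?_
          rw [degree_rowExponent]
          exact fun h' => hμ ((hY μ).2 h')
    | succ m ih =>
      intro f hf hdeg h
      set S := Y.filter fun μ => wt μ + m + 1 = B with hS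
      set g := ∑ μ ∈ S, MvPowerSeries.coeff (rowExponent μ) f • schurFunction R μ with hg
      have hgmem : g ∈ Submodule.span R (Set.range (schurFunction R)) :=
        Submodule.sum_mem _ fun μ _ => Submodule.smul_mem _ _ (Submodule.subset_span ⟨μ, rfl⟩)
      have hgcoeff : ∀ d, MvPowerSeries.coeff d g = ∑ μ ∈ S,
          MvPowerSeries.coeff (rowExponent μ) f * MvPowerSeries.coeff d (schurFunction R μ) := by
        intro d
        rw [hg, map_sum]
        simp
      rw [← sub_add_cancel f g]
      refine Submodule.add_mem _ (ih (f - g) ?_ ?_ ?_) hgmem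
      · intro i d
        rw [map_sub, map_sub, hf i d, hgcoeff, hgcoeff]
        congr 1
        exact Finset.sum_congr rfl fun μ _ => by rw [isSwapInvariant_schurFunction R μ i d]
      · intro d hd
        rw [map_sub, hdeg d hd, hgcoeff, Finset.sum_eq_zero, sub_zero]
        intro μ hμ
        rw [coeff_schurFunction_eq_zero, mul_zero]
        rwa [(hY μ).1 (Finset.mem_filter.1 hμ).1]
      · intro ν hν hνB
        rw [map_sub, hgcoeff]
        by_cases hνS : ν ∈ S
        · rw [Finset.sum_eq_single_of_mem ν hνS, coeff_rowExponent_self, mul_one, sub_self]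
          intro μ hμ hne
          rw [coeff_schurFunction_of_weight_le, mul_zero]
          · have h1 := (Finset.mem_filter.1 hμ).2
            have h2 := (Finset.mem_filter.1 hνS).2
            change wt ν ≤ wt μ
            omega
          · exact fun h => hne (rowExponent_injective h).symm
        · have hlt : wt ν + m + 1 ≠ B := fun h => hνS (Finset.mem_filter.2 ⟨hν, h⟩)
          rw [h ν hν (by omega), Finset.sum_eq_zero, sub_zero]
          intro μ hμ
          have h1 := (Finset.mem_filter.1 hμ).2
          rw [coeff_schurFunction_of_weight_le, mul_zero]
          · change wt ν ≤ wt μ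
            omega
          · rintro h
            have := rowExponent_injective h
            subst this
            exact hνS hμ
  obtain ⟨c, hc⟩ := (Finsupp.mem_span_range_iff_exists_finsupp).1
    (key B f hf hdeg fun μ _ h => absurd h (by omega))
  exact ⟨c, hc.symm⟩

end SchurExpansion

/-! ### Unimodality of products of `t`-numbers -/

section Unimodal

/-- The coefficients are nonnegative, vanish beyond `m`, are symmetric about `m / 2`, and increase up
to the middle. -/
structure IsSymmetricUnimodal (f : ℚ[X]) (m : ℕ) : Prop where
  nonneg : ∀ i, 0 ≤ f.coeff i
  eq_zero : ∀ i, m < i → f.coeff i = 0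
  symm : ∀ i j, i + j = m → f.coeff i = f.coeff j
  le_succ : ∀ i, 2 * i + 1 ≤ m → f.coeff i ≤ f.coeff (i + 1)

/-- The index `j` may lie beyond the middle: it is then reflected to `m - j`, which is still at
least `i`. -/
theorem IsSymmetricUnimodal.coeff_le {f : ℚ[X]} {m : ℕ} (h : IsSymmetricUnimodal f m) {i j : ℕ}
    (hij : i ≤ j) (hm : i + j ≤ m) : f.coeff i ≤ f.coeff j := by
  have key : ∀ k, i ≤ k → 2 * k ≤ m + 1 → f.coeff i ≤ f.coeff k := by
    intro k hk
    induction k, hk using Nat.le_induction with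
    | base => exact fun _ => le_rfl
    | succ k hk ih => exact fun h' => (ih (by omega)).trans (h.le_succ k (by omega))
  by_cases hj : 2 * j ≤ m + 1
  · exact key j hij hj
  · rw [h.symm j (m - j) (by omega)]
    exact key (m - j) (by omega) (by omega)

theorem IsSymmetricUnimodal.mul_tNumber {f : ℚ[X]} {m : ℕ} (h : IsSymmetricUnimodal f m) (a : ℕ) :
    IsSymmetricUnimodal (f * tNumber (1 + a)) (m + a) := by
  have hc : ∀ i, (f * tNumber (1 + a)).coeff i =
      ∑ k ∈ Finset.range (a + 1), if k ≤ i then f.coeff (i - k) else 0 := by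
    intro i
    rw [tNumber, Finset.mul_sum, finsetSum_coeff, add_comm 1 a]
    simp only [coeff_mul_X_pow']
  refine ⟨fun i => ?_, fun i hi => ?_, fun i j hij => ?_, fun i hi => ?_⟩
  · rw [hc]
    refine Finset.sum_nonneg fun k _ => ?_
    split_ifs
    · exact h.nonneg _
    · exact le_rfl
  · rw [hc]
    refine Finset.sum_eq_zero fun k hk => ?_
    rw [Finset.mem_range] at hk
    split_ifs
    · exact h.eq_zero _ (by omega)
    · rfl
  -- The coefficients of the product are sums over windows of length `a + 1`; reflecting the window
  -- matches the symmetry of `f`.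
  · rw [hc, hc, ← Finset.sum_range_reflect]
    refine Finset.sum_congr rfl fun k hk => ?_
    rw [Finset.mem_range] at hk
    split_ifs with h1 h2 h2
    · exact h.symm _ _ (by omega)
    · exact h.eq_zero _ (by omega)
    · exact (h.eq_zero _ (by omega)).symm
    · rfl
  -- Consecutive windows share all terms but one at each end, which leaves the comparison of the
  -- coefficients of `f` at `i - a` and `i + 1`, the former read as 0 when `i < a`. The indices add
  -- up to at most `m`.
  · rw [hc, hc, Finset.sum_range_succ, Finset.sum_range_succ', add_comm]
    simp only [Nat.zero_le, if_true, Nat.sub_zero, Nat.add_le_add_iff_right, Nat.add_sub_add_right]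
    rw [add_comm]
    refine add_le_add_right ?_ _
    split_ifs
    · exact h.coeff_le (by omega) (by omega)
    · exact h.nonneg _

theorem isSymmetricUnimodal_prod {ι : Type*} (s : Finset ι) (a : ι → ℕ) :
    IsSymmetricUnimodal (∏ v ∈ s, tNumber (1 + a v)) (∑ v ∈ s, a v) := by
  classical
  induction s using Finset.induction_on with
  | empty =>
    simp only [Finset.prod_empty, Finset.sum_empty]
    refine ⟨fun i => ?_, fun i hi => ?_, fun i j hij => ?_, fun i hi => by omega⟩
    · rw [coeff_one]; split_ifs <;> simp
    · rw [coeff_one, if_neg (by omega)]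
    · rw [show i = j by omega]
  | insert v s hv ih =>
    rw [Finset.prod_insert hv, Finset.sum_insert hv, mul_comm, add_comm (a v)]
    exact ih.mul_tNumber (a v)

theorem IsSymmetricUnimodal.isPositiveUnimodalPalindromic {f : ℚ[X]} {m : ℕ}
    (h : IsSymmetricUnimodal f m) : IsPositiveUnimodalPalindromic f m where
  natDegree_le := natDegree_le_iff_coeff_eq_zero.2 fun i hi => h.eq_zero i hi
  nonneg := h.nonneg
  increasing i hi := h.le_succ i (by omega)
  middle := h.symm _ _ (by omega)
  decreasing i h1 h2 := by
    rw [h.symm (i + 1) (m - i - 1) (by omega), h.symm i (m - i - 1 + 1) (by omega)]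
    exact h.le_succ _ (by omega)
  palindromic i hi := h.symm _ _ (by omega)

end Unimodal

/-! ### Natural unit interval orders -/

section UnitInterval

variable {V : Finset ℕ}

theorem upDegree_eq_card (G : SimpleGraph V) (v : V) :
    upDegree G v = ((neighborsIn G Finset.univ v).filter fun w => v < w).card := by
  rw [upDegree, ← Set.ncard_coe_finset]
  congr 1
  ext w
  simp [mem_neighborsIn]

/-- Each edge is counted at its smaller endpoint. This identifies the number of edges with the
center parameter of the product of t-numbers. -/
theorem ncard_edgeSet_eq_sum_upDegree (G : SimpleGraph V) :
    G.edgeSet.ncard = ∑ v, upDegree G v := by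
  classical
  let E : Finset (V × V) := Finset.univ.filter fun e => G.Adj e.1 e.2 ∧ e.1 < e.2
  have himage : G.edgeSet = (fun e : V × V => s(e.1, e.2)) '' E := by
    ext e
    induction e using Sym2.ind with
    | _ x y =>
      simp only [SimpleGraph.mem_edgeSet, Set.mem_image, E, Finset.coe_filter, Finset.mem_univ,
        true_and, Set.mem_ofPred_eq, Prod.exists]
      constructor
      · intro h
        rcases lt_or_gt_of_ne h.ne with hlt | hlt
        · exact ⟨x, y, ⟨h, hlt⟩, rfl⟩
        · exact ⟨y, x, ⟨h.symm, hlt⟩, Sym2.eq_swap⟩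
      · rintro ⟨a, b, ⟨h, -⟩, hab⟩
        rcases Sym2.eq_iff.1 hab with ⟨rfl, rfl⟩ | ⟨rfl, rfl⟩
        · exact h
        · exact h.symm
  have hinj : Set.InjOn (fun e : V × V => s(e.1, e.2)) E := by
    rintro ⟨a, b⟩ h ⟨a', b'⟩ h' hab
    simp only [E, Finset.coe_filter, Finset.mem_univ, true_and, Set.mem_ofPred_eq] at h h'
    rcases Sym2.eq_iff.1 hab with ⟨rfl, rfl⟩ | ⟨rfl, rfl⟩
    · rfl
    · exact absurd h.2 h'.2.not_gt
  rw [himage, hinj.ncard_image, Set.ncard_coe_finset,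
    Finset.card_eq_sum_card_fiberwise (f := Prod.fst) (t := Finset.univ)
      (fun _ _ => Finset.mem_coe.2 (Finset.mem_univ _))]
  refine Finset.sum_congr rfl fun v _ => ?_
  rw [upDegree_eq_card]
  refine Eq.trans (congrArg Finset.card ?_)
    (Finset.card_map ⟨fun w => (v, w), Prod.mk_right_injective v⟩)
  ext ⟨a, b⟩
  simp only [E, Finset.mem_filter, Finset.mem_univ, true_and, Finset.mem_map, mem_neighborsIn,
    Function.Embedding.coeFn_mk, Prod.mk.injEq]
  constructor
  · rintro ⟨h, rfl⟩
    exact ⟨b, h, rfl, rfl⟩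
  · rintro ⟨w, h, rfl, rfl⟩
    exact ⟨h, rfl⟩

/-- The largest vertex has no larger neighbour and contributes the factor 1, so the product may run
over all vertices. -/
theorem prod_nthVertex {n : ℕ} (hV : V.card = n) (G : SimpleGraph V) :
    ∏ j : Fin (n - 1), tNumber (1 + upDegree G (nthVertex hV (Fin.castLE (Nat.sub_le n 1) j))) =
      ∏ v, tNumber (1 + upDegree G v) := by
  rw [← Equiv.prod_comp (V.orderIsoOfFin hV).toEquiv]
  cases n with
  | zero => rfl
  | succ k =>
    rw [Fin.prod_univ_castSucc]
    have hlast : upDegree G ((V.orderIsoOfFin hV).toEquiv (Fin.last k)) = 0 := by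
      rw [upDegree_eq_card, Finset.card_eq_zero, Finset.filter_eq_empty_iff]
      intro w _ hw
      have h1 : (V.orderIsoOfFin hV).symm w ≤ Fin.last k := Fin.le_last _
      rw [OrderIso.symm_apply_le] at h1
      exact h1.not_gt hw
    have hone : tNumber (1 + 0) = 1 := by simp [tNumber]
    rw [hlast, hone, mul_one]
    rfl

variable {P : PartialOrder V}

theorem incGraph_adj_iff {x y : V} (h : x ≠ y) :
    (incGraph P).Adj x y ↔ ¬ P.lt x y ∧ ¬ P.lt y x := by
  have h1 : P.lt x y ↔ P.le x y :=
    ⟨fun h' => ((P.lt_iff_le_not_ge x y).1 h').1,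
      fun h' => (P.lt_iff_le_not_ge x y).2 ⟨h', fun h'' => h (P.le_antisymm x y h' h'')⟩⟩
  have h2 : P.lt y x ↔ P.le y x :=
    ⟨fun h' => ((P.lt_iff_le_not_ge y x).1 h').1,
      fun h' => (P.lt_iff_le_not_ge y x).2 ⟨h', fun h'' => h (P.le_antisymm x y h'' h')⟩⟩
  rw [h1, h2]
  rfl

theorem lt_trans_of_partialOrder {x y z : V} (h : P.lt x y) (h' : P.lt y z) : P.lt x z := by
  rw [P.lt_iff_le_not_ge] at h h' ⊢
  exact ⟨P.le_trans _ _ _ h.1 h'.1, fun h'' => h.2 (P.le_trans _ _ _ h'.1 h'')⟩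

/-- The upper neighbours of a vertex form a clique. -/
theorem incGraph_adj_of_common_lower (hP : IsNaturalUnitIntervalOrder P) (c x y : V) (hcx : c < x)
    (hcy : c < y) (hxy : x ≠ y) (h1 : (incGraph P).Adj c x) (h2 : (incGraph P).Adj c y) :
    (incGraph P).Adj x y := by
  rw [incGraph_adj_iff hxy]
  -- If `x` and `y` were comparable, then `c`, incomparable to both, would have to lie between them.
  exact ⟨fun h => (hP.2 x c y h h1.symm h2.symm).1.not_gt hcx,
    fun h => (hP.2 y c x h h2.symm h1.symm).1.not_gt hcy⟩

/-- Every element between two adjacent vertices is adjacent to both. -/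
theorem incGraph_adj_of_between (hP : IsNaturalUnitIntervalOrder P) (u v w : V) (huv : u < v)
    (hvw : v < w) (h : (incGraph P).Adj u w) : (incGraph P).Adj u v ∧ (incGraph P).Adj v w := by
  have huw := (incGraph_adj_iff (huv.trans hvw).ne).1 h
  have hvu' : ¬ P.lt v u := fun h' => (hP.1 _ _ h').not_gt huv
  have hwv' : ¬ P.lt w v := fun h' => (hP.1 _ _ h').not_gt hvw
  constructor
  -- Non-adjacency of `u` and `v` means that `u` is `P`-below `v`. If `v` and `w` are incomparable,
  -- then `w` is forced between `u` and `v`; otherwise transitivity makes `u` and `w` comparable.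
  -- The other half is the mirror image.
  · by_contra h1
    have h2 : P.lt u v := by
      by_contra h2
      exact h1 ((incGraph_adj_iff huv.ne).2 ⟨h2, hvu'⟩)
    by_cases h3 : (incGraph P).Adj v w
    · exact (hP.2 u w v h2 h h3).2.not_gt hvw
    · have h4 : P.lt v w := by
        by_contra h4
        exact h3 ((incGraph_adj_iff hvw.ne).2 ⟨h4, hwv'⟩)
      exact huw.1 (lt_trans_of_partialOrder h2 h4)
  · by_contra h1
    have h2 : P.lt v w := by
      by_contra h2
      exact h1 ((incGraph_adj_iff hvw.ne).2 ⟨h2, hwv'⟩)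
    by_cases h3 : (incGraph P).Adj u v
    · exact (hP.2 v u w h2 h3.symm h.symm).1.not_gt huv
    · have h4 : P.lt u v := by
        by_contra h4
        exact h3 ((incGraph_adj_iff huv.ne).2 ⟨h4, hvu'⟩)
      exact huw.1 (lt_trans_of_partialOrder h4 h2)

-- A column is recorded by sending each vertex to its row number plus one. The row condition on
-- tableaux is vacuous in a single column.
open Classical in
theorem sum_PTableau_columnShape {n : ℕ} (hV : V.card = n) :
    ∑ T : PTableau P (columnShape n), (X : ℚ[X]) ^ T.inv =
      ∑ f ∈ packedFunctions (Finset.univ : Finset V),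
        (if Set.InjOn f (Finset.univ : Finset V) ∧
          ∀ x ∈ Finset.univ, ∀ y ∈ Finset.univ, f y = f x + 1 → ¬ P.lt y x then
          X ^ edgeCount (incGraph P) (fun i j => j < i) Finset.univ f else 0) := by
  have hcell : ∀ c : {c : ℕ × ℕ // c ∈ columnShape n}, c.1 = (c.1.1, 0) ∧ c.1.1 < n := fun c =>
    have h := mem_columnShape.1 (show (c.1.1, c.1.2) ∈ columnShape n from c.2)
    ⟨Prod.ext rfl h.2, h.1⟩
  have hcellext : ∀ c c' : {c : ℕ × ℕ // c ∈ columnShape n}, c.1.1 = c'.1.1 → c = c' :=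
    fun c c' h => Subtype.ext (by rw [(hcell c).1, (hcell c').1, h])
  rw [← Finset.sum_filter]
  refine Finset.sum_bij (fun T _ => fun v => T.row v + 1) ?_ ?_ ?_ ?_
  · intro T _
    rw [Finset.mem_filter]
    refine ⟨mem_packedFunctions.2 ⟨fun a => by simp, fun a k h1 hk => ?_⟩, ?_, ?_⟩
    · have ha := (hcell (T.1.symm a)).2
      have hk' : k ≤ (T.1.symm a).1.1 + 1 := hk
      have hmem : (k - 1, 0) ∈ columnShape n := mem_columnShape.2 ⟨by omega, rfl⟩
      refine ⟨T.1 ⟨_, hmem⟩, ?_⟩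
      rw [PTableau.row, Equiv.symm_apply_apply]
      exact Nat.sub_add_cancel h1
    · intro x _ y _ hxy
      exact T.1.symm.injective (hcellext _ _ (Nat.succ_injective hxy))
    · intro x _ y _ hxy
      have hy := hcell (T.1.symm y)
      have hx := hcell (T.1.symm x)
      have hrow : (T.1.symm y).1.1 = (T.1.symm x).1.1 + 1 := Nat.succ_injective hxy
      have h1 : ((T.1.symm x).1.1, 0) ∈ columnShape n := mem_columnShape.2 ⟨hx.2, rfl⟩
      have h2 : ((T.1.symm x).1.1 + 1, 0) ∈ columnShape n :=
        mem_columnShape.2 ⟨hrow ▸ hy.2, rfl⟩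
      have h3 := T.2.2 _ 0 h1 h2
      rwa [show (⟨((T.1.symm x).1.1, 0), h1⟩ : {c : ℕ × ℕ // c ∈ columnShape n}) = T.1.symm x from
        hcellext _ _ rfl,
        show (⟨((T.1.symm x).1.1 + 1, 0), h2⟩ : {c : ℕ × ℕ // c ∈ columnShape n}) = T.1.symm y from
        hcellext _ _ hrow.symm, Equiv.apply_symm_apply, Equiv.apply_symm_apply] at h3
  · intro T _ T' _ h
    apply Subtype.ext
    have : T.1.symm = T'.1.symm := by
      ext1 v
      exact hcellext _ _ (Nat.succ_injective (congrFun h v))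
    rw [← Equiv.symm_symm T.1, this, Equiv.symm_symm]
  · intro f hf
    rw [Finset.mem_filter] at hf
    obtain ⟨hf, hinj, hlt⟩ := hf
    have hpos : ∀ v, 1 ≤ f v := fun v => pos_of_mem_packed hf (Finset.mem_univ v)
    have hle : ∀ v, f v ≤ n := by
      intro v
      have := Fintype.mem_piFinset.1 (Finset.mem_filter.1 hf).1 v
      rw [Finset.mem_range, Fintype.card_coe, hV] at this
      omega
    let F : V → {c : ℕ × ℕ // c ∈ columnShape n} := fun v =>
      ⟨(f v - 1, 0), mem_columnShape.2 ⟨by have := hpos v; have := hle v; omega, rfl⟩⟩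
    have hF : Function.Bijective F := by
      have : Fintype {c : ℕ × ℕ // c ∈ columnShape n} :=
        inferInstanceAs (Fintype {c : ℕ × ℕ // c ∈ (columnShape n).cells})
      rw [Fintype.bijective_iff_injective_and_card]
      constructor
      · intro x y hxy
        have h1 : f x - 1 = f y - 1 := congrArg (fun c => c.1.1) hxy
        have := hpos x
        have := hpos y
        exact hinj (Finset.mem_coe.2 (Finset.mem_univ x)) (Finset.mem_coe.2 (Finset.mem_univ y))
          (by omega)
      · rw [Fintype.card_coe, hV, ← Nat.card_eq_fintype_card]
        have : Nat.card {c : ℕ × ℕ // c ∈ (columnShape n).cells} = (columnShape n).card := by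
          rw [Nat.card_eq_fintype_card, Fintype.card_coe]
        exact (card_columnShape n).symm.trans this.symm
    -- A tableau sends cells to vertices, whereas `F` sends vertices to cells.
    let e := (Equiv.ofBijective F hF).symm
    have he : ∀ c, f (e c) = c.1.1 + 1 := by
      intro c
      have h1 : F (e c) = c := (Equiv.ofBijective F hF).apply_symm_apply c
      have h2 : f (e c) - 1 = c.1.1 := congrArg (fun c => c.1.1) h1
      have := hpos (e c)
      omega
    refine ⟨⟨e, ?_, ?_⟩, Finset.mem_univ _, ?_⟩
    · intro i j _ h'
      have := (mem_columnShape.1 h').2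
      omega
    · intro i j h h'
      exact hlt _ (Finset.mem_univ _) _ (Finset.mem_univ _) (by rw [he, he])
    · funext v
      have := hpos v
      change f v - 1 + 1 = f v
      omega
  · intro T _
    rw [edgeCount_univ_eq_ncard]
    simp only [Nat.add_lt_add_iff_right]
    rfl

theorem coeff_chromaticQSym_eq_zero (G : SimpleGraph V) {d : ℕ →₀ ℕ} (h : d.degree ≠ V.card) :
    MvPowerSeries.coeff d (chromaticQSym G) = 0 := by
  rw [coeff_chromaticQSym]
  refine Finset.sum_eq_zero fun κ hκ => absurd ?_ h
  rw [← mem_withContent.1 hκ, degree_valueContent, Fintype.card_coe]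

/-- The functional turns the power series into the signed sum of `alternating_sum_proper`; the
values of a packed function on all of `V` are positive, so lowering them by one changes neither
properness nor ascents. -/
theorem alternatingCoeff_chromaticQSym (hP : IsNaturalUnitIntervalOrder P) :
    alternatingCoeff V.card (chromaticQSym (incGraph P)) =
      ∏ v, tNumber (1 + upDegree (incGraph P) v) := by
  classical
  have h := alternatingCoeff_eq_sum_packedFunctions (coeff_chromaticQSym (incGraph P))
  rw [Fintype.card_coe] at h
  simp only [upDegree_eq_card]
  refine h.trans (Eq.trans ?_
    (alternating_sum_proper (incGraph_adj_of_common_lower hP) Finset.univ))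
  refine Finset.sum_congr rfl fun f hf => ?_
  have hpos : ∀ v, 1 ≤ f v := fun v => pos_of_mem_packed hf (Finset.mem_univ v)
  have hiff : (∀ x ∈ Finset.univ, ∀ y ∈ Finset.univ, (incGraph P).Adj x y → f x - 1 ≠ f y - 1) ↔
      ∀ x ∈ Finset.univ, ∀ y ∈ Finset.univ, (incGraph P).Adj x y → f x ≠ f y := by
    refine forall₂_congr fun x _ => forall₂_congr fun y _ => ?_
    have := hpos x
    have := hpos y
    refine forall_congr' fun _ => ?_
    omega
  have hcount : edgeCount (incGraph P) (· < ·) Finset.univ (fun v => f v - 1) =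
      edgeCount (incGraph P) (· < ·) Finset.univ f := by
    refine edgeCount_congr fun x _ y _ => ?_
    have := hpos x
    have := hpos y
    omega
  rw [chromaticWeight, hcount]
  simp only [hiff, mul_ite, mul_zero]
  rw [Finset.card_univ, Fintype.card_coe]
  congr

end UnitInterval

theorem theorem6p6 {V : Finset ℕ} (P : PartialOrder V) (hP : IsNaturalUnitIntervalOrder P)
    {n : ℕ} (hV : V.card = n) :
    (∑ T : PTableau P (columnShape n), (X : ℚ[X]) ^ T.inv =
      ∏ j : Fin (n - 1),
        tNumber (1 + upDegree (incGraph P) (nthVertex hV (Fin.castLE (Nat.sub_le n 1) j)))) ∧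
    (∃ c : YoungDiagram →₀ ℚ[X], IsSchurExpansion (chromaticQSym (incGraph P)) c) ∧
    (∀ c : YoungDiagram →₀ ℚ[X], IsSchurExpansion (chromaticQSym (incGraph P)) c →
      c (columnShape n) =
        ∏ j : Fin (n - 1),
          tNumber (1 + upDegree (incGraph P) (nthVertex hV (Fin.castLE (Nat.sub_le n 1) j))) ∧
      IsPositiveUnimodalPalindromic (c (columnShape n)) (incGraph P).edgeSet.ncard) := by
  classical
  rw [prod_nthVertex]
  refine ⟨?_, ?_, fun c hc => ?_⟩
  · rw [sum_PTableau_columnShape hV]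
    simp only [upDegree_eq_card]
    exact sum_columns (lt := P.lt) hP.1 (fun _ _ _ => lt_trans_of_partialOrder)
      (fun _ _ => incGraph_adj_iff) (incGraph_adj_of_common_lower hP) Finset.univ
  · exact exists_isSchurExpansion (isSwapInvariant_chromaticQSym (incGraph_adj_of_between hP))
      fun d hd => coeff_chromaticQSym_eq_zero _ hd
  · subst hV
    -- The functional evaluates the coefficient in any given expansion, so uniqueness of the
    -- expansion is not needed.
    rw [← alternatingCoeff_of_isSchurExpansion hc, alternatingCoeff_chromaticQSym hP,
      ncard_edgeSet_eq_sum_upDegree]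
    exact ⟨rfl, (isSymmetricUnimodal_prod _ _).isPositiveUnimodalPalindromic⟩
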